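/- Let $p$ be an odd prime, let $\mathbf F$ be a field of characteristic $p$, and let $L=\bigoplus_{i\ge 1}L_i$ be an infinite-dimensional graded Lie algebra of maximal class over $\mathbf F$; that is, $L$ is infinite-dimensional, $\dim L_1=2$, $\dim L_i\le 1$ for $i\ge 2$, and $L$ is generated by $L_1$. For $i\ge 2$ let $C_i=C_{L_1}(L_i)=\{x\in L_1 : [v,x]=0 \text{ for all } v\in L_i\}$ be the two-step centralizers. If $n$ is the least index with $C_n\ne C_2$, then $C_2$ and $C_n$ are called the first and the second two-step centralizer, and $C_2,\dots,C_n$ is called the first constituent, of length $n$. Any other constituent is a segment $C_{i+1},\dots,C_{i+m}$ ($m\ge 1$) with $i\ge 2$, $C_i\ne C_2$, $C_{i+m}\ne C_2$ and $C_{i+1}=\dots=C_{i+m-1}=C_2$; its length is $m$. Let $q=p^h$ and $r=p^k$ with $k\ge 1$, let $0\le\beta<h$, and let $s\ge 1$ be an integer. Suppose that there is an initial segment of the sequence $(C_i)_{i\ge 2}$ that involves only the first two two-step centralizers, and that the corresponding initial segment of the sequence of constituent lengths of $L$ is $$2q,\ q^{r-2},\ 2q-p^\beta,\ (q^{r-2},2q)^{s-1},\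 q^{r-2},\ 2q-p^\beta,$$ where exponents on terms or on bracketed blocks denote the number of repetitions. Then $s=p^l$ for some integer $l\ge 0$. -/

import Mathlib

/-!
Graded Lie algebras of maximal class, their two-step centralizers and their constituents.
-/

namespace MaxClass

section

variable {F L : Type*} [Field F] [LieRing L] [LieAlgebra F L]

/-- `L = ⨁_{i ≥ 1} L_i` (the summand of degree `0` of an `ℕ`-grading being zero) is an algebra of
maximal class: `dim L_1 = 2`, `dim L_i ≤ 1` for `i ≥ 2`, and `L` is generated by `L_1`. -/
structure IsMaximalClass (A : ℕ → Submodule F L) [GradedLieAlgebra A] : Prop where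
  zero_eq_bot : A 0 = ⊥
  rank_one : Module.rank F (A 1) = 2
  rank_le_one : ∀ i, 2 ≤ i → Module.rank F (A i) ≤ 1
  generated : LieSubalgebra.lieSpan F L (A 1 : Set L) = ⊤

/-- The two-step centralizer `C_i = C_{L_1}(L_i)`. -/
def twoStepCentralizer (A : ℕ → Submodule F L) (i : ℕ) : Submodule F L where
  carrier := {x | x ∈ A 1 ∧ ∀ v ∈ A i, ⁅v, x⁆ = 0}
  add_mem' := by
    rintro x y ⟨hx, hx'⟩ ⟨hy, hy'⟩
    exact ⟨(A 1).add_mem hx hy, fun v hv => by rw [lie_add, hx' v hv, hy' v hv, add_zero]⟩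
  zero_mem' := ⟨(A 1).zero_mem, fun v _ => lie_zero v⟩
  smul_mem' := by
    rintro c x ⟨hx, hx'⟩
    exact ⟨(A 1).smul_mem c hx, fun v hv => by rw [lie_smul, hx' v hv, smul_zero]⟩

/-- The second two-step centralizer (in order of occurrence) first occurs in weight `n`. The first
constituent is then `C_2, …, C_n`; by convention its length is `n`. -/
def IsFirstConstituent (A : ℕ → Submodule F L) (n : ℕ) : Prop :=
  2 ≤ n ∧ twoStepCentralizer A n ≠ twoStepCentralizer A 2 ∧
    ∀ j, 2 ≤ j → j < n → twoStepCentralizer A j = twoStepCentralizer A 2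

/-- `C_{i+1}, …, C_{i+m}` is a constituent of length `m` (other than the first one). -/
def IsConstituent (A : ℕ → Submodule F L) (i m : ℕ) : Prop :=
  2 ≤ i ∧ 1 ≤ m ∧ twoStepCentralizer A i ≠ twoStepCentralizer A 2 ∧
    twoStepCentralizer A (i + m) ≠ twoStepCentralizer A 2 ∧
    ∀ j, i < j → j < i + m → twoStepCentralizer A j = twoStepCentralizer A 2

/-- The constituents following weight `i` have, in order, the lengths in the given list. -/
def HasConstituentsFrom (A : ℕ → Submodule F L) : ℕ → List ℕ → Prop
  | _, [] => True
  | i, m :: ms => IsConstituent A i m ∧ HasConstituentsFrom A (i + m) ms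

/-- The sequence of constituent lengths begins with the given list. The corresponding initial
segment of the sequence of two-step centralizers is `C_2, …, C_N`, with `N` the sum of the list. -/
def ConstituentLengthsBeginWith (A : ℕ → Submodule F L) : List ℕ → Prop
  | [] => True
  | n :: ms => IsFirstConstituent A n ∧ HasConstituentsFrom A n ms

/-- The segment `C_2, …, C_N` involves only the first two two-step centralizers, in order of
occurrence in the whole sequence. -/
def OnlyFirstTwoUpTo (A : ℕ → Submodule F L) (N : ℕ) : Prop :=
  ∀ i, 2 ≤ i → i ≤ N → twoStepCentralizer A i = twoStepCentralizer A 2 ∨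
    ∃ n, IsFirstConstituent A n ∧ twoStepCentralizer A i = twoStepCentralizer A n

end

/-- The list `2q, q^{r-2}, 2q - d, (q^{r-2}, 2q)^{s-1}, q^{r-2}, 2q - d`, exponents denoting
repetition. -/
def initialPattern (q r d s : ℕ) : List ℕ :=
  [2 * q] ++ List.replicate (r - 2) q ++ [2 * q - d] ++
    (List.replicate (s - 1) (List.replicate (r - 2) q ++ [2 * q])).flatten ++
    List.replicate (r - 2) q ++ [2 * q - d]

end MaxClass

/-!
Let `C_2 = F y` and `C_n = F x` be the first two two-step centralizers. Over `F(X)` the element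
`z = x + X y` centralizes no homogeneous component, so there is a homogeneous basis with `e_1`
proportional to `y` and `⁅e_i, z⁆ = e_{i+1}`. Writing `⁅e_i, e_1⁆ = ε_i e_{i+1}`, one may arrange
`ε_i = 0` where `C_i = C_2` and `ε_i = 1` where `C_i = C_n`. Since `e_{k+1} = ⁅e_1, z, …, z⁆`, the
bracket `⁅e_m, e_{k+1}⁆` is the `k`-th difference `((1 - σ)^k ε)_m` times `e_{m+k+1}`, with `σ` the
left shift. So skew-symmetry and the Jacobi identity of `L` become identities between iterated
differences of `ε`, and these are computable because `(1 - σ)^{p^t} = 1 - σ^{p^t}` in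
characteristic `p`.

Write `s = p^l u` with `u` prime to `p`, and suppose `u ≥ 2`. The identities force `ε` to continue
the given pattern by `p^l` further blocks `q^{r-2}, 2q`. In a suitable weight the skew-symmetry of
this continued pattern fails by exactly `u`, which is nonzero in `F`.
-/

namespace MaxClass

section Differences

variable {R : Type*} [CommRing R]

/-- The left shift `σ` of sequences. -/
def shift : Module.End R (ℕ → R) := LinearMap.funLeft R R Nat.succ

@[simp] theorem shift_apply (f : ℕ → R) (m : ℕ) : shift f m = f (m + 1) := rfl

theorem shift_pow_apply (j : ℕ) (f : ℕ → R) (m : ℕ) : (shift ^ j) f m = f (m + j) := by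
  induction j generalizing m with
  | zero => rfl
  | succ j ih => simp [pow_succ', ih, add_assoc, add_comm 1 j]

/-- The iterated difference `((1 - σ) ^ k f) m`, where `σ` is the shift. If `[e_i, z] = e_{i+1}` and
`[e_i, y] = f i • e_{i+1}` for all `i`, then it is the coefficient of `e_{m+k+1}` in
`[e_m, [y, z, …, z]]`, with `k` factors `z`. -/
def iterDiff (f : ℕ → R) (m k : ℕ) : R := ((1 - shift) ^ k : Module.End R (ℕ → R)) f m

@[simp] theorem iterDiff_zero (f : ℕ → R) (m : ℕ) : iterDiff f m 0 = f m := rfl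

theorem iterDiff_succ (f : ℕ → R) (m k : ℕ) :
    iterDiff f m (k + 1) = iterDiff f m k - iterDiff f (m + 1) k := by
  simp [iterDiff, pow_succ']

theorem iterDiff_congr {f g : ℕ → R} {m k : ℕ} (h : ∀ x, m ≤ x → x ≤ m + k → f x = g x) :
    iterDiff f m k = iterDiff g m k := by
  induction k generalizing m with
  | zero => exact h m le_rfl le_rfl
  | succ k ih =>
    rw [iterDiff_succ, iterDiff_succ, ih fun x h₁ h₂ => h x h₁ (by omega),
      ih fun x h₁ h₂ => h x (by omega) (by omega)]

theorem iterDiff_add (f g : ℕ → R) (m k : ℕ) :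
    iterDiff (f + g) m k = iterDiff f m k + iterDiff g m k := by
  simp [iterDiff]

theorem iterDiff_eq_zero {f : ℕ → R} {m k : ℕ} (h : ∀ x, m ≤ x → x ≤ m + k → f x = 0) :
    iterDiff f m k = 0 :=
  (iterDiff_congr (g := 0) h).trans (by simp [iterDiff])

theorem iterDiff_iterDiff (f : ℕ → R) (a m k : ℕ) :
    iterDiff (fun x => iterDiff f x a) m k = iterDiff f m (a + k) := by
  simp only [iterDiff, add_comm a k, pow_add, Module.End.mul_apply]

theorem iterDiff_const (c : R) (m k : ℕ) : iterDiff (fun _ => c) m (k + 1) = 0 := by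
  rw [add_comm, ← iterDiff_iterDiff]
  exact iterDiff_eq_zero fun x _ _ => by simp [iterDiff_succ]

theorem iterDiff_eq_sum (f : ℕ → R) (m k : ℕ) :
    iterDiff f m k = ∑ j ∈ Finset.range (k + 1), (-1) ^ j * (k.choose j : R) * f (m + j) := by
  have expansion : (1 - shift : Module.End R (ℕ → R)) ^ k =
      ∑ j ∈ Finset.range (k + 1), ((-1) ^ j * (k.choose j : R)) • shift ^ j := by
    rw [sub_eq_neg_add, ← neg_one_smul R, (Commute.one_right _).add_pow]
    refine Finset.sum_congr rfl fun j _ => ?_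
    rw [one_pow, mul_one, smul_pow, ← nsmul_eq_mul', ← Nat.cast_smul_eq_nsmul R, smul_smul,
      mul_comm]
  simp [iterDiff, expansion, shift_pow_apply]

theorem iterDiff_eq_of_support {f : ℕ → R} {m k y : ℕ} (h₁ : m ≤ y) (h₂ : y ≤ m + k)
    (h : ∀ x, m ≤ x → x ≤ m + k → x ≠ y → f x = 0) :
    iterDiff f m k = (-1) ^ (y - m) * (k.choose (y - m) : R) * f y := by
  rw [iterDiff_eq_sum, Finset.sum_eq_single_of_mem (y - m) (by grind), Nat.add_sub_cancel' h₁]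
  intro j hj hne
  rw [h (m + j) (by grind) (by grind) (by grind), mul_zero]

variable (p : ℕ) [hp : Fact p.Prime] [CharP R p]

theorem iterDiff_prime_pow_add (f : ℕ → R) (m t k : ℕ) :
    iterDiff f m (p ^ t + k) = iterDiff f m k - iterDiff f (m + p ^ t) k := by
  have : CharP (Module.End R (ℕ → R)) p :=
    Module.charP_end ⟨1, by ext; simp [Ideal.mem_torsionOf_iff, funext_iff]⟩
  rw [iterDiff, pow_add, sub_pow_char_pow_of_commute _ _ (Commute.one_left _), one_pow]
  simp [shift_pow_apply, iterDiff]

theorem iterDiff_dilate (f : ℕ → R) (m t k i u : ℕ) :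
    iterDiff f (m + p ^ t * i) (p ^ t * u + k) =
      iterDiff (fun j => iterDiff f (m + p ^ t * j) k) i u := by
  induction u generalizing i with
  | zero => simp
  | succ u ih =>
    rw [iterDiff_succ, ← ih, ← ih, show p ^ t * (u + 1) + k = p ^ t + (p ^ t * u + k) by ring,
      iterDiff_prime_pow_add p, mul_add_one, add_assoc m]

variable (R) in
theorem neg_one_pow_mul_choose_prime_pow_sub_one {t j : ℕ} (hj : j < p ^ t) :
    (-1 : R) ^ j * ((p ^ t - 1).choose j : R) = 1 := by
  induction j with
  | zero => simp
  | succ j ih =>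
    have pascal : ((p ^ t - 1).choose j : R) + ((p ^ t - 1).choose (j + 1) : R) = 0 := by
      rw [← Nat.cast_add, ← Nat.choose_succ_succ, Nat.succ_eq_add_one,
        Nat.sub_add_cancel (by omega), CharP.cast_eq_zero_iff R p]
      exact hp.out.dvd_choose_pow (by omega) (by omega)
    linear_combination ih (by omega) - (-1) ^ j * pascal

theorem iterDiff_window_eq {f : ℕ → R} {m t y : ℕ}
    (h₁ : m ≤ y) (h₂ : y < m + p ^ t) (h : ∀ x, m ≤ x → x < m + p ^ t → x ≠ y → f x = 0) :
    iterDiff f m (p ^ t - 1) = f y := by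
  rw [iterDiff_eq_of_support h₁ (by omega) fun x hx hx' => h x hx (by omega),
    neg_one_pow_mul_choose_prime_pow_sub_one R p (by omega), one_mul]

variable (R) in
theorem choose_prime_pow_cast (n v : ℕ) : (n.choose (p ^ v) : R) = (n / p ^ v : ℕ) := by
  have lucas :=
    Choose.choose_modEq_choose_mul_prod_range_choose (n := n) (k := p ^ v) (p := p) v
  rw [Nat.div_self (pow_pos hp.out.pos v), Nat.choose_one_right, Finset.prod_eq_one,
    Nat.cast_one, mul_one, Int.natCast_modEq_iff] at lucas
  · exact (CharP.cast_eq_iff_mod_eq R p).2 lucas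
  · intro i hi
    rw [Nat.pow_div (Finset.mem_range.1 hi).le hp.out.pos,
      Nat.mod_eq_zero_of_dvd (dvd_pow_self p (by grind)), Nat.choose_zero_right]

variable (R) in
theorem choose_prime_pow_cast_eq_neg {n v c w e : ℕ} (he : e < p ^ v)
    (h : n + c * p ^ v = p ^ (v + 1) * w + e) : (n.choose (p ^ v) : R) = -(c : R) := by
  have hpos : 0 < p ^ v := pow_pos hp.out.pos v
  have digit : n / p ^ v + c = p * w := by
    rw [← Nat.add_mul_div_right _ _ hpos, h, pow_succ, mul_assoc, Nat.mul_add_div hpos,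
      Nat.div_eq_of_lt he, add_zero]
  rw [choose_prime_pow_cast R p, eq_neg_iff_add_eq_zero, ← Nat.cast_add, digit, Nat.cast_mul,
    CharP.cast_eq_zero, zero_mul]

variable (R) in
theorem choose_cast_eq_zero_of_mod_lt {n e v : ℕ} (he : e < p ^ v) (hn : n % p ^ v < e) :
    (n.choose e : R) = 0 := by
  have lucas := Choose.choose_modEq_choose_mul_prod_range_choose (n := n) (k := e) (p := p) v
  have lucas_mod := Choose.choose_modEq_prod_range_choose (p := p) (hn.trans he) he
  have digits (i : ℕ) (hi : i ∈ Finset.range v) : n % p ^ v / p ^ i % p = n / p ^ i % p := by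
    obtain ⟨c, hc⟩ := pow_dvd_pow p (Finset.mem_range.1 hi)
    rw [hc, pow_succ, mul_assoc, Nat.mod_mul_right_div_self, Nat.mod_mul_right_mod]
  rw [Nat.choose_eq_zero_of_lt hn, Finset.prod_congr rfl fun i hi => by rw [digits i hi],
    ← Nat.cast_prod] at lucas_mod
  rw [Nat.div_eq_of_lt he, Nat.choose_zero_right, Nat.cast_one, one_mul] at lucas
  simpa using (CharP.intCast_eq_intCast R p).2 (lucas.trans lucas_mod.symm)

end Differences

section Gaps

variable {R : Type*} [CommRing R]

/-- The identities satisfied by the structure constants `[e_i, z] = e_{i+1}`,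
`[e_i, y] = ε_i e_{i+1}` of an algebra in which `e_{i+1}` is proportional to `[y, z, …, z]`:
skew-symmetry of the bracket of `e_{a+1}` and `e_{b+1}`, and the Jacobi identity for `e_{m+1}`,
`e_{k+1}`, `y`. -/
structure IsAdmissible (ε : ℕ → R) : Prop where
  skew : ∀ a b, iterDiff ε (a + 1) b = -iterDiff ε (b + 1) a
  jacobi : ∀ m k, iterDiff ε (m + 1) k * ε (m + k + 2) =
    ε (m + 1) * iterDiff ε (m + 2) k + ε (k + 1) * iterDiff ε (m + 1) (k + 1)

namespace IsAdmissible

variable {ε : ℕ → R} (hε : IsAdmissible ε)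
include hε

theorem jacobi_of_pos {m k : ℕ} (hm : 1 ≤ m) (hk : 1 ≤ k) :
    iterDiff ε m (k - 1) * ε (m + k) = ε m * iterDiff ε (m + 1) (k - 1) +
      ε k * (iterDiff ε m (k - 1) - iterDiff ε (m + 1) (k - 1)) := by
  obtain ⟨m, rfl⟩ := Nat.exists_eq_add_of_le' hm
  obtain ⟨k, rfl⟩ := Nat.exists_eq_add_of_le' hk
  have jacobi := hε.jacobi m k
  rw [iterDiff_succ] at jacobi
  rwa [show m + 1 + (k + 1) = m + k + 2 by ring]

variable [IsDomain R]

theorem eq_zero_of_zero_zero {m k : ℕ} (hm : 1 ≤ m) (hk : 1 ≤ k) (hεm : ε m = 0) (hεk : ε k = 0)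
    (hne : iterDiff ε m (k - 1) ≠ 0) : ε (m + k) = 0 := by
  have jacobi := hε.jacobi_of_pos hm hk
  rw [hεm, hεk, zero_mul, zero_mul, add_zero] at jacobi
  exact (mul_eq_zero.1 jacobi).resolve_left hne

theorem eq_one_of_one_one {m k : ℕ} (hm : 1 ≤ m) (hk : 1 ≤ k) (hεm : ε m = 1) (hεk : ε k = 1)
    (hne : iterDiff ε m (k - 1) ≠ 0) : ε (m + k) = 1 := by
  have jacobi := hε.jacobi_of_pos hm hk
  rw [hεm, hεk] at jacobi
  exact mul_left_cancel₀ hne (by linear_combination jacobi)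

variable {p : ℕ} [hp : Fact p.Prime] {h : ℕ}

variable [CharP R p]

theorem zero_after_of_zero_before (hsmall : ∀ x, 1 ≤ x → x < 2 * p ^ h → ε x = 0)
    {N : ℕ} (hN₁ : 1 ≤ N) (hN : ε N ≠ 0) (hbefore : ∀ x, N < x + p ^ h → x < N → ε x = 0) :
    ∀ x, N < x → x < N + p ^ h → ε x = 0 := by
  have hpos : 0 < p ^ h := pow_pos hp.out.pos h
  have hN₂ : 2 * p ^ h ≤ N := by
    by_contra! hlt
    exact hN (hsmall N hN₁ hlt)
  intro x
  induction x using Nat.strong_induction_on with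
  | _ x ih =>
    intro h₁ h₂
    suffices ε (x - p ^ h + p ^ h) = 0 by rwa [Nat.sub_add_cancel (by omega)] at this
    refine hε.eq_zero_of_zero_zero (by omega) (by omega) (hbefore _ (by omega) (by omega))
      (hsmall _ (by omega) (by omega)) ?_
    rwa [iterDiff_window_eq p (y := N) (by omega) (by omega)]
    intro y hy₁ hy₂ hy₃
    rcases lt_or_gt_of_ne hy₃ with hlt | hgt
    · exact hbefore y (by omega) hlt
    · exact ih y (by omega) hgt (by omega)

theorem exists_eq_pow_of_short_gap (hsmall : ∀ x, 1 ≤ x → x < 2 * p ^ h → ε x = 0)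
    {N i d : ℕ} (hN₁ : 1 ≤ N) (hN : ε N ≠ 0) (hbefore : ∀ x, N < x + p ^ h → x < N → ε x = 0)
    (hd₀ : 0 < d) (hd : d < p ^ h) (hi : i + d = N + 2 * p ^ h) (hεi : ε i ≠ 0)
    (hgap : ∀ x, N < x → x < i → ε x = 0) : ∃ t, t < h ∧ d = p ^ t := by
  have hN₂ : 2 * p ^ h ≤ N := by
    by_contra! hlt
    exact hN (hsmall N hN₁ hlt)
  obtain ⟨t, w, hw, rfl⟩ := Nat.exists_eq_pow_mul_and_not_dvd hd₀.ne' p hp.out.ne_one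
  have hw₀ : 0 < w := Nat.pos_of_mul_pos_left hd₀
  have hpos : 0 < p ^ t := pow_pos hp.out.pos t
  have hle : p ^ t ≤ p ^ t * w := Nat.le_mul_of_pos_right _ hw₀
  have hth : t < h := (Nat.pow_lt_pow_iff_right hp.out.one_lt).1 (by omega)
  refine ⟨t, hth, ?_⟩
  by_contra hne
  obtain ⟨g, hg⟩ := pow_dvd_pow p hth
  have coeff : ((i - N + p ^ t - 1).choose (p ^ t) : R) ≠ 0 := by
    rw [choose_prime_pow_cast_eq_neg R p (c := w) (w := 2 * g) (e := p ^ t - 1) (by omega)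
      (by grind), neg_ne_zero, Ne, CharP.cast_eq_zero_iff R p]
    exact hw
  apply hεi
  rw [show i = (N - p ^ t) + (i - N + p ^ t) by omega]
  refine hε.eq_zero_of_zero_zero (by omega) (by omega) (hbefore _ (by omega) (by omega))
    (hsmall _ (by omega) (by omega)) ?_
  rw [iterDiff_eq_of_support (y := N) (by omega) (by omega), Nat.sub_sub_self (by omega)]
  · exact mul_ne_zero (mul_ne_zero (by simp) coeff) hN
  · intro x hx₁ hx₂ hx₃
    rcases lt_or_gt_of_ne hx₃ with hlt | hgt
    · exact hbefore x (by omega) hlt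
    · exact hgap x hgt (by omega)

theorem eq_one_of_full_gap (h2q : ε (2 * p ^ h) = 1) {N : ℕ} (hN₁ : 1 ≤ N) (hN : ε N = 1)
    (hgap : ∀ x, N < x → x < N + 2 * p ^ h → ε x = 0) : ε (N + 2 * p ^ h) = 1 := by
  have hpos : 0 < p ^ h := pow_pos hp.out.pos h
  refine hε.eq_one_of_one_one hN₁ (by omega) hN h2q ?_
  rw [show 2 * p ^ h - 1 = p ^ h + (p ^ h - 1) by omega, iterDiff_prime_pow_add p,
    iterDiff_window_eq p (y := N) (by omega) (by omega) fun x _ _ _ => hgap x (by omega) (by omega),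
    iterDiff_eq_zero fun x _ _ => hgap x (by omega) (by omega), hN, sub_zero]
  exact one_ne_zero

omit [IsDomain R] in
theorem mul_add_prime_pow_eq (h2q : ε (2 * p ^ h) = 1) {i : ℕ} (hi : p ^ h < i)
    (hbefore : ∀ x, i ≤ x + p ^ h → x < i → ε x = 0)
    (hafter : ∀ x, i < x → x < i + p ^ h → ε x = 0) :
    ε i * ε (i + p ^ h) = 2 * ε i - ε (i + p ^ h) := by
  have hpos : 0 < p ^ h := pow_pos hp.out.pos h
  have jacobi := hε.jacobi_of_pos (m := i - p ^ h) (k := 2 * p ^ h) (by omega) (by omega)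
  have w₁ : iterDiff ε (i - p ^ h) (p ^ h - 1) = 0 :=
    iterDiff_eq_zero fun x _ _ => hbefore x (by omega) (by omega)
  have w₂ : iterDiff ε i (p ^ h - 1) = ε i :=
    iterDiff_window_eq p (by omega) (by omega) fun x _ _ _ => hafter x (by omega) (by omega)
  have w₃ : iterDiff ε (i - p ^ h + 1) (p ^ h - 1) = ε i :=
    iterDiff_window_eq p (by omega) (by omega) fun x _ _ _ => hbefore x (by omega) (by omega)
  have w₄ : iterDiff ε (i + 1) (p ^ h - 1) = ε (i + p ^ h) :=
    iterDiff_window_eq p (by omega) (by omega) fun x _ _ _ => hafter x (by omega) (by omega)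
  rw [h2q, hbefore (i - p ^ h) (by omega) (by omega),
    show i - p ^ h + 2 * p ^ h = i + p ^ h by omega,
    show 2 * p ^ h - 1 = p ^ h + (p ^ h - 1) by omega, iterDiff_prime_pow_add p,
    iterDiff_prime_pow_add p, show i - p ^ h + p ^ h = i by omega,
    show i - p ^ h + 1 + p ^ h = i + 1 by omega, w₁, w₂, w₃, w₄] at jacobi
  linear_combination -jacobi

omit [IsDomain R] in
theorem one_add_mul_add_prime_pow_eq (h3q : ε (3 * p ^ h) = 1) {N d i : ℕ} (hN : ε N = 1)
    (hNh : p ^ h < N) (hd₀ : 0 < d) (hd : d < p ^ h) (hi : i + d = N + 2 * p ^ h)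
    (hbefore : ∀ x, N < x + p ^ h → x < N → ε x = 0) (hgap : ∀ x, N < x → x < i → ε x = 0)
    (hafter : ∀ x, i < x → x < i + p ^ h → ε x = 0) :
    (1 + ε i) * ε (i + p ^ h) = 3 * ε i - ε (i + p ^ h) := by
  have hpos : 0 < p ^ h := pow_pos hp.out.pos h
  have jacobi := hε.jacobi_of_pos (m := N - d) (k := 3 * p ^ h) (by omega) (by omega)
  have around (x : ℕ) (h₁ : N < x + p ^ h) (h₂ : x < i) (h₃ : x ≠ N) : ε x = 0 := by
    rcases lt_or_gt_of_ne h₃ with hlt | hgt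
    · exact hbefore x h₁ hlt
    · exact hgap x hgt h₂
  have w₁ : iterDiff ε (N - d) (p ^ h - 1) = ε N :=
    iterDiff_window_eq p (by omega) (by omega) fun x _ _ _ => around x (by omega) (by omega) ‹_›
  have w₂ : iterDiff ε (N - d + 1) (p ^ h - 1) = ε N :=
    iterDiff_window_eq p (by omega) (by omega) fun x _ _ _ => around x (by omega) (by omega) ‹_›
  have w₃ : iterDiff ε (i - p ^ h) (p ^ h - 1) = 0 :=
    iterDiff_eq_zero fun x _ _ => hgap x (by omega) (by omega)
  have w₄ : iterDiff ε (i - p ^ h + 1) (p ^ h - 1) = ε i :=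
    iterDiff_window_eq p (by omega) (by omega) fun x _ _ _ => hgap x (by omega) (by omega)
  have w₅ : iterDiff ε i (p ^ h - 1) = ε i :=
    iterDiff_window_eq p (by omega) (by omega) fun x _ _ _ => hafter x (by omega) (by omega)
  have w₆ : iterDiff ε (i + 1) (p ^ h - 1) = ε (i + p ^ h) :=
    iterDiff_window_eq p (by omega) (by omega) fun x _ _ _ => hafter x (by omega) (by omega)
  rw [hbefore (N - d) (by omega) (by omega), h3q, show N - d + 3 * p ^ h = i + p ^ h by omega,
    show 3 * p ^ h - 1 = p ^ h + (p ^ h + (p ^ h - 1)) by omega] at jacobi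
  simp only [iterDiff_prime_pow_add p] at jacobi
  rw [show N - d + p ^ h + p ^ h = i by omega, show N - d + p ^ h = i - p ^ h by omega,
    show N - d + 1 + p ^ h + p ^ h = i + 1 by omega,
    show N - d + 1 + p ^ h = i - p ^ h + 1 by omega, w₁, w₂, w₃, w₄, w₅, w₆, hN] at jacobi
  linear_combination jacobi

theorem eq_one_of_short_gap (hsmall : ∀ x, 1 ≤ x → x < 2 * p ^ h → ε x = 0)
    (h2q : ε (2 * p ^ h) = 1) (h3q : ε (3 * p ^ h) = 1) {N d i : ℕ} (hN₁ : 1 ≤ N) (hN : ε N = 1)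
    (hd₀ : 0 < d) (hd : d < p ^ h) (hi : i + d = N + 2 * p ^ h) (hεi : ε i ≠ 0)
    (hbefore : ∀ x, N < x + p ^ h → x < N → ε x = 0) (hgap : ∀ x, N < x → x < i → ε x = 0) :
    ε i = 1 ∧ ε (i + p ^ h) = 1 := by
  have hN₂ : 2 * p ^ h ≤ N := by
    by_contra! hlt
    exact one_ne_zero (hN ▸ hsmall N hN₁ hlt)
  have hafter := hε.zero_after_of_zero_before hsmall (N := i) (by omega) hεi
    fun x _ hx => hgap x (by omega) hx
  have first := hε.mul_add_prime_pow_eq h2q (i := i) (by omega)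
    (fun x _ hx => hgap x (by omega) hx) hafter
  have second := hε.one_add_mul_add_prime_pow_eq h3q hN (by omega) hd₀ hd hi hbefore hgap hafter
  have eq : ε (i + p ^ h) = ε i := by linear_combination second - first
  rw [eq] at first ⊢
  have one : ε i = 1 := mul_left_cancel₀ hεi (by linear_combination first)
  exact ⟨one, one⟩

end IsAdmissible

end Gaps

section SkewDefect

variable {R : Type*} [CommRing R]

/-- The failure of skew-symmetry of the bracket of `e_{a+1}` and `e_{b+1}`. -/
def skewDefect (f : ℕ → R) (a b : ℕ) : R := iterDiff f (a + 1) b + iterDiff f (b + 1) a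

theorem IsAdmissible.skewDefect_eq_zero {ε : ℕ → R} (hε : IsAdmissible ε) (a b : ℕ) :
    skewDefect ε a b = 0 := by
  rw [skewDefect, hε.skew, neg_add_cancel]

theorem skewDefect_add (f g : ℕ → R) (a b : ℕ) :
    skewDefect (f + g) a b = skewDefect f a b + skewDefect g a b := by
  simp only [skewDefect, iterDiff_add]
  ring

theorem skewDefect_congr {f g : ℕ → R} {a b : ℕ} (h : ∀ x, 1 ≤ x → x ≤ a + b + 1 → f x = g x) :
    skewDefect f a b = skewDefect g a b := by
  rw [skewDefect, skewDefect, iterDiff_congr fun x _ _ => h x (by omega) (by omega),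
    iterDiff_congr (f := f) fun x _ _ => h x (by omega) (by omega)]

theorem iterDiff_single {m k y e : ℕ} (c : R) (hy : y + e = m + k) (he : e ≤ k) :
    iterDiff (Pi.single y c) m k = (-1) ^ (k - e) * (k.choose e : R) * c := by
  rw [iterDiff_eq_of_support (y := y) (by omega) (by omega) fun x _ _ hx =>
    Pi.single_eq_of_ne (M := fun _ => R) hx c,
    Pi.single_eq_same, show y - m = k - e by omega, Nat.choose_symm he]

theorem iterDiff_of_two_of_one_of_zero {f : ℕ → R} {c : ℕ} (h₂ : ∀ j ≤ c, f j = 2)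
    (h₁ : f (c + 1) = 1) (h₀ : f (c + 2) = 0) : iterDiff f 0 (c + 2) = (-1) ^ c * c := by
  have split : iterDiff f 0 (c + 2) =
      iterDiff ((fun _ => 2) + Pi.single (c + 1) (-1) + Pi.single (c + 2) (-2)) 0 (c + 2) := by
    refine iterDiff_congr fun j _ hj => ?_
    obtain hjc | rfl | rfl : j ≤ c ∨ j = c + 1 ∨ j = c + 2 := by omega
    · simp [h₂ j hjc, show j ≠ c + 1 by omega, show j ≠ c + 2 by omega]
    · simp only [h₁, Pi.add_apply, Pi.single_eq_same]
      norm_num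
    · simp [h₀]
  rw [split, iterDiff_add, iterDiff_add, iterDiff_const,
    iterDiff_single (e := 1) _ (by omega) (by omega),
    iterDiff_single (e := 0) _ (by omega) (by omega), show c + 2 - 1 = c + 1 by omega,
    Nat.sub_zero, Nat.choose_one_right, Nat.choose_zero_right]
  push_cast
  ring

theorem skewDefect_single {a b y e : ℕ} (c : R) (hy : y + e = a + b + 1) (hea : e ≤ a)
    (heb : e ≤ b) : skewDefect (Pi.single y c) a b =
      ((-1) ^ (b - e) * (b.choose e : R) + (-1) ^ (a - e) * (a.choose e : R)) * c := by
  rw [skewDefect, iterDiff_single c (e := e) (by omega) heb,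
    iterDiff_single c (e := e) (by omega) hea, add_mul]

theorem skewDefect_eq_add_of_deviation {f g : ℕ → R} {a b y e : ℕ} (hy : y + e = a + b + 1)
    (hea : e ≤ a) (heb : e ≤ b) (h : ∀ x, 1 ≤ x → x ≤ a + b + 1 → x ≠ y → f x = g x) :
    skewDefect f a b = skewDefect g a b +
      ((-1) ^ (b - e) * (b.choose e : R) + (-1) ^ (a - e) * (a.choose e : R)) * (f y - g y) := by
  rw [← skewDefect_single _ hy hea heb, ← skewDefect_add]
  refine skewDefect_congr fun x h₁ h₂ => ?_
  obtain rfl | hx := eq_or_ne x y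
  · simp
  · simp [h x h₁ h₂ hx, hx]

end SkewDefect

section Pattern

section Comb

variable {R : Type*} [Zero R] [One R]

/-- The periodic sequence with terms `1` at the multiples `q * a` of `q` with `a ≢ 1` modulo `r`,
and `0` elsewhere. -/
def comb (q r y : ℕ) : R := if q ∣ y ∧ y / q % r ≠ 1 then 1 else 0

/-- The sequence of two-step centralizers with constituent lengths
`2q, q^{r-2}, 2q - d, (q^{r-2}, 2q)^{s-1}, q^{r-2}, 2q - d, (q^{r-2}, 2q)^∞`. -/
def pattern (q r d s x : ℕ) : R :=
  comb q r (x + if x ≤ q * r then 0 else if x ≤ q * r * (s + 1) then d else 2 * d)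

/-- The part of `comb` (shifted by `d`) that lies in the `s`-th period. -/
def combPeriod (q r d s x : ℕ) : R :=
  if q * r * s < x ∧ x ≤ q * r * (s + 1) then comb q r (x + d) else 0

variable {q r d s x : ℕ}

theorem comb_mul_of_ne (hq : 0 < q) {a : ℕ} (ha : a % r ≠ 1) : comb (R := R) q r (q * a) = 1 :=
  if_pos ⟨dvd_mul_right q a, by rwa [Nat.mul_div_cancel_left _ hq]⟩

theorem comb_mul_of_eq (hq : 0 < q) {a : ℕ} (ha : a % r = 1) : comb (R := R) q r (q * a) = 0 :=
  if_neg fun ⟨_, hne⟩ => hne (by rwa [Nat.mul_div_cancel_left _ hq])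

theorem comb_of_not_dvd (h : ¬q ∣ x) : comb (R := R) q r x = 0 := if_neg fun h' => h h'.1

theorem comb_of_between {a : ℕ} (h₁ : q * a < x) (h₂ : x < q * a + q) :
    comb (R := R) q r x = 0 :=
  comb_of_not_dvd (Nat.not_dvd_of_lt_of_lt_mul_succ h₁ h₂)

theorem comb_of_near {a : ℕ} (h₁ : q * a < x + q) (h₂ : x < q * a + q) (hne : x ≠ q * a) :
    comb (R := R) q r x = 0 := by
  rcases lt_or_gt_of_ne hne with hlt | hgt
  · obtain ⟨a, rfl⟩ := Nat.exists_eq_add_of_le'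
      (show 1 ≤ a from Nat.pos_of_mul_pos_left (show 0 < q * a by omega))
    rw [mul_add_one] at *
    exact comb_of_between (a := a) (by omega) hlt
  · exact comb_of_between hgt h₂

theorem comb_add_period (hq : 0 < q) (y b : ℕ) :
    comb (R := R) q r (y + q * r * b) = comb q r y := by
  have dvd_iff : q ∣ y + q * r * b ↔ q ∣ y := by
    rw [mul_assoc, Nat.dvd_add_left (dvd_mul_right q _)]
  have div_mod : (y + q * r * b) / q % r = y / q % r := by
    rw [mul_assoc, Nat.add_mul_div_left _ _ hq, Nat.add_mul_mod_self_left]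
  simp only [comb, dvd_iff, div_mod]

theorem comb_of_gap (hr : 2 ≤ r) {y b : ℕ} (h₁ : q * r * b < y) (h₂ : y < q * r * b + 2 * q) :
    comb (R := R) q r y = 0 := by
  rw [mul_assoc] at h₁ h₂
  have middle : q * (r * b + 1) = q * (r * b) + q := mul_add_one _ _
  obtain rfl | hne := eq_or_ne y (q * (r * b + 1))
  · exact comb_mul_of_eq (by omega) (by rw [Nat.mul_add_mod, Nat.mod_eq_of_lt (by omega)])
  · exact comb_of_near (by omega) (by omega) hne

theorem comb_add_mul_of_two_le (hq : 0 < q) {b i : ℕ} (hi₁ : 2 ≤ i) (hi₂ : i ≤ r) :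
    comb (R := R) q r (q * r * b + q * i) = 1 := by
  rw [add_comm, comb_add_period hq]
  refine comb_mul_of_ne hq ?_
  rcases hi₂.lt_or_eq with hlt | rfl
  · rw [Nat.mod_eq_of_lt hlt]
    omega
  · rw [Nat.mod_self]
    exact zero_ne_one

theorem combPeriod_of_lt (hr : 2 ≤ r) (h : x + d < q * r * s + 2 * q) :
    combPeriod (R := R) q r d s x = 0 := by
  rw [combPeriod, ite_eq_right_iff]
  exact fun hx => comb_of_gap hr (b := s) (by omega) h

theorem combPeriod_of_gt (hr : 2 ≤ r) (hd : d < 2 * q) (h : q * r * (s + 1) < x + d) :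
    combPeriod (R := R) q r d s x = 0 := by
  rw [combPeriod, ite_eq_right_iff]
  exact fun hx => comb_of_gap hr h (by omega)

theorem combPeriod_of_near {a : ℕ} (h₁ : q * a < x + d + q) (h₂ : x + d < q * a + q)
    (hne : x + d ≠ q * a) : combPeriod (R := R) q r d s x = 0 := by
  rw [combPeriod, comb_of_near h₁ h₂ hne, ite_self]

theorem combPeriod_eq_one (hd : d < q) {i : ℕ} (hi₁ : 2 ≤ i) (hi₂ : i ≤ r)
    (h : x + d = q * r * s + q * i) : combPeriod (R := R) q r d s x = 1 := by
  have hqi : q * 2 ≤ q * i := Nat.mul_le_mul_left q hi₁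
  have hqr : q * i ≤ q * r := Nat.mul_le_mul_left q hi₂
  rw [combPeriod, if_pos ⟨by omega, by rw [mul_add_one]; omega⟩, h,
    comb_add_mul_of_two_le (by omega) hi₁ hi₂]

theorem pattern_of_le (h : x ≤ q * r) : pattern (R := R) q r d s x = comb q r x := by
  rw [pattern, if_pos h, add_zero]

theorem pattern_of_mid (h₁ : q * r < x) (h₂ : x ≤ q * r * (s + 1)) :
    pattern (R := R) q r d s x = comb q r (x + d) := by
  rw [pattern, if_neg (by omega), if_pos h₂]

theorem pattern_of_gt (h : q * r * (s + 1) < x) :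
    pattern (R := R) q r d s x = comb q r (x + 2 * d) := by
  have : q * r ≤ q * r * (s + 1) := Nat.le_mul_of_pos_right _ (by omega)
  rw [pattern, if_neg (by omega), if_neg (by omega)]

end Comb

variable {R : Type*} [CommRing R] {q r d s : ℕ}

-- Consecutive periods cancel, except that the phase is shifted across the `s`-th one.
theorem pattern_sub_pattern {x : ℕ} (hr : 2 ≤ r) (hd : d < q) (hx : q * r < x) :
    pattern (R := R) q r d s x - pattern q r d s (x + q * r) =
      combPeriod q r d s x - combPeriod q r d s (x + d) := by
  have succ_period : q * r * (s + 1) = q * r * s + q * r := mul_add_one _ _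
  have comb_add (y : ℕ) : comb (R := R) q r (y + q * r) = comb q r y := by
    simpa using comb_add_period (R := R) (r := r) (by omega) y 1
  rcases lt_or_ge (q * r * (s + 1)) x with late | h₁
  · rw [pattern_of_gt late, pattern_of_gt (by omega), add_right_comm, comb_add,
      combPeriod_of_gt hr (by omega) (by omega), combPeriod_of_gt hr (by omega) (by omega),
      sub_self, sub_self]
  rw [pattern_of_mid hx h₁]
  rcases lt_or_ge (q * r * s) x with h₂ | early
  · rw [pattern_of_gt (by omega), add_right_comm, comb_add, combPeriod, if_pos ⟨h₂, h₁⟩]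
    rcases lt_or_ge (q * r * (s + 1)) (x + d) with h₃ | h₃
    · rw [combPeriod_of_gt hr (by omega) (by omega),
        comb_of_gap hr (y := x + 2 * d) (b := s + 1) (by omega) (by omega)]
    · rw [combPeriod, if_pos ⟨by omega, h₃⟩, add_assoc, ← two_mul]
  · rw [pattern_of_mid (by omega) (by omega), add_right_comm, comb_add,
      combPeriod_of_lt hr (by omega), combPeriod_of_lt hr (by omega), sub_self, sub_self]

variable (p : ℕ) [Fact p.Prime] [CharP R p]

theorem iterDiff_pattern {n β : ℕ} (hr : 2 ≤ r) (hqr : q * r = p ^ n) (hd : d = p ^ β) (hdq : d < q)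
    {m k : ℕ} (hm : q * r < m) :
    iterDiff (pattern (R := R) q r d s) m (q * r + k) =
      iterDiff (combPeriod q r d s) m (d + k) := by
  rw [← iterDiff_iterDiff, ← iterDiff_iterDiff]
  refine iterDiff_congr fun x hx _ => ?_
  have period := pattern_sub_pattern (R := R) (s := s) hr hdq (show q * r < x by omega)
  have qr_diff := iterDiff_prime_pow_add p (pattern (R := R) q r d s) x n 0
  have d_diff := iterDiff_prime_pow_add p (combPeriod (R := R) q r d s) x β 0
  rw [← hqr] at qr_diff
  rw [← hd] at d_diff
  exact qr_diff.trans (period.trans d_diff.symm)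

theorem skewDefect_pattern {n β : ℕ} (hr : 2 ≤ r) (hqr : q * r = p ^ n) (hd : d = p ^ β)
    (hdq : d < q) (a b : ℕ) : skewDefect (pattern (R := R) q r d s) (q * r + a) (q * r + b) =
      iterDiff (combPeriod q r d s) (q * r + a + 1) (d + b) +
      iterDiff (combPeriod q r d s) (q * r + b + 1) (d + a) := by
  rw [skewDefect, iterDiff_pattern p hr hqr hd hdq (by omega),
    iterDiff_pattern p hr hqr hd hdq (by omega)]

end Pattern

section Defect

variable {R : Type*} [CommRing R] (p : ℕ) [hp : Fact p.Prime] [CharP R p] {q r d s n β : ℕ}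

/-- Two lattice points at distance `Q` after the `s`-th period, and the columns of `σ ^ Q` through
it, are all that contribute; of the columns only the `c`-th meets the period. -/
theorem skewDefect_pattern_eq_add (hr : 2 ≤ r) (hqr : q * r = p ^ n) (hd : d = p ^ β) (hdq : d < q)
    {a b c M Q N : ℕ} (hQ : Q = p ^ N) (hs : q * r * s = Q * (c + 2)) (hb : b + d = q * r + Q)
    (hqrQ : q * r ≤ Q) (ha : a + 1 + d = Q * (c + 1) + M) (hM : q * r < M)
    (hM' : M < 2 * Q + 2 * q) :
    skewDefect (pattern (R := R) q r d s) a b = combPeriod q r d s (a + 1) +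
      (-1) ^ c * (c + 1) * iterDiff (combPeriod q r d s) (b + 1 + Q * c) (M - (q * r + 1)) := by
  have h2q : q * 2 ≤ q * r := Nat.mul_le_mul_left q hr
  have hc₁ : Q * (c + 1) = Q * c + Q := mul_add_one _ _
  have hc₂ : Q * (c + 2) = Q * c + Q + Q := by ring
  have hs₁ : q * r * (s + 1) = Q * (c + 2) + q * r := by rw [mul_add_one, hs]
  obtain ⟨a, rfl⟩ := Nat.exists_eq_add_of_le (show q * r ≤ a by omega)
  obtain ⟨b, rfl⟩ := Nat.exists_eq_add_of_le (show q * r ≤ b by omega)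
  have lattice := iterDiff_prime_pow_add p (combPeriod (R := R) q r d s) (q * r + a + 1) N 0
  have columns := iterDiff_dilate p (combPeriod (R := R) q r d s) (q * r + b + 1) N
    (M - (q * r + 1)) 0 (c + 1)
  rw [← hQ, mul_zero, add_zero] at columns
  rw [← hQ] at lattice
  rw [skewDefect_pattern p hr hqr hd hdq, show d + b = Q + 0 by omega, lattice,
    show d + a = Q * (c + 1) + (M - (q * r + 1)) by omega,
    columns, iterDiff_zero, iterDiff_zero,
    combPeriod_of_gt hr (x := q * r + a + 1 + Q) (by omega) (by omega), sub_zero,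
    iterDiff_eq_of_support (y := c) (by omega) (by omega), Nat.sub_zero,
    Nat.choose_succ_self_right, Nat.cast_succ]
  intro i _ hi hne
  refine iterDiff_eq_zero fun x hx₁ hx₂ => ?_
  rcases Nat.lt_or_ge c i with hci | hic
  · obtain rfl : i = c + 1 := by omega
    exact combPeriod_of_gt hr (by omega) (by omega)
  · have : Q * (i + 1) ≤ Q * c := Nat.mul_le_mul_left Q (by omega)
    rw [mul_add_one] at this
    exact combPeriod_of_lt hr (by omega)

theorem skewDefect_pattern_eq_zero (hr : 2 ≤ r) (hqr : q * r = p ^ n) (hd : d = p ^ β)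
    (hdq : d < q) {a b c M Q N : ℕ} (hQ : Q = p ^ N) (hs : q * r * s = Q * (c + 2))
    (hb : b + d = q * r + Q) (hqrQ : q * r ≤ Q) (ha : a + 1 + d = Q * (c + 1) + M)
    (hM : q * r < M) (hM' : M < Q + 2 * q) : skewDefect (pattern (R := R) q r d s) a b = 0 := by
  have hc₁ : Q * (c + 1) = Q * c + Q := mul_add_one _ _
  have hc₂ : Q * (c + 2) = Q * c + Q + Q := by ring
  rw [skewDefect_pattern_eq_add p hr hqr hd hdq hQ hs hb hqrQ ha hM (by omega),
    combPeriod_of_lt hr (by omega), iterDiff_eq_zero fun x _ _ => combPeriod_of_lt hr (by omega),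
    mul_zero, add_zero]

/-- The two contributions to the defect, `1` from the lattice point and `c + 1` from the column, add
up because all the signs are `+`. -/
theorem skewDefect_pattern_eq_add_two (hp₂ : p ≠ 2) (hr : 2 ≤ r) (hqr : q * r = p ^ n)
    (hd : d = p ^ β) (hdq : d < q) {a b c Q N : ℕ} (hQ : Q = p ^ N)
    (hs : q * r * s = Q * (c + 2)) (hc : Odd c) (hb : b + d = q * r + Q) (hqrQ : q * r ≤ Q)
    (ha : a + 1 + d = Q * (c + 2) + 2 * q) :
    skewDefect (pattern (R := R) q r d s) a b = c + 2 := by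
  have h2q : q * 2 ≤ q * r := Nat.mul_le_mul_left q hr
  have hc₁ : Q * (c + 1) = Q * c + Q := mul_add_one _ _
  have hc₂ : Q * (c + 2) = Q * c + Q + Q := by ring
  have hodd : Odd p := hp.out.odd_of_ne_two hp₂
  have column_odd : Odd (Q + 2 * q - (q * r + 1)) := by
    obtain ⟨x, hx⟩ : Odd Q := hQ ▸ hodd.pow
    obtain ⟨y, hy⟩ : Odd (q * r) := hqr ▸ hodd.pow
    exact ⟨x - y + q - 1, by omega⟩
  have column : iterDiff (combPeriod (R := R) q r d s) (b + 1 + Q * c)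
      (Q + 2 * q - (q * r + 1)) = -1 := by
    rw [iterDiff_eq_of_support (y := q * r * s + 2 * q - d) (by omega) (by omega),
      combPeriod_eq_one hdq (i := 2) le_rfl hr (by omega), show q * r * s + 2 * q - d -
        (b + 1 + Q * c) = Q + 2 * q - (q * r + 1) by omega, Nat.choose_self, column_odd.neg_one_pow,
      Nat.cast_one, mul_one, mul_one]
    exact fun x _ _ _ => combPeriod_of_lt hr (by omega)
  rw [skewDefect_pattern_eq_add p hr hqr hd hdq hQ hs hb hqrQ (M := Q + 2 * q) (by omega)
    (by omega) (by omega), column, combPeriod_eq_one hdq (i := 2) le_rfl hr (by omega),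
    hc.neg_one_pow]
  ring

theorem combPeriod_of_near_first {x : ℕ} (hr : 2 ≤ r) (h : x + d < q * r * s + 2 * q + q)
    (hne : x + d ≠ q * r * s + 2 * q) : combPeriod (R := R) q r d s x = 0 := by
  have first : q * (r * s + 2) = q * r * s + 2 * q := by ring
  rcases Nat.lt_or_ge (x + d) (q * r * s + 2 * q) with hlt | hge
  · exact combPeriod_of_lt hr hlt
  · exact combPeriod_of_near (a := r * s + 2) (by omega) (by omega) (by omega)

theorem skewDefect_pattern_eq_zero_after (hr : 3 ≤ r) (hqr : q * r = p ^ n) (hd : d = p ^ β)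
    (hdq : d < q) (hdvd : d ∣ q) {a b c e Q N : ℕ} (hQ : Q = p ^ N) (hqQ : q ∣ Q)
    (hs : q * r * s = Q * (c + 2)) (hb : b + d = q * r + Q) (hqrQ : q * r ≤ Q)
    (ha : a + 1 + d = Q * (c + 2) + 2 * q + e) (he : 0 < e) (hed : e < d) :
    skewDefect (pattern (R := R) q r d s) a b = 0 := by
  have hqr3 : q * 3 ≤ q * r := Nat.mul_le_mul_left q hr
  have hc₁ : Q * (c + 1) = Q * c + Q := mul_add_one _ _
  have hc₂ : Q * (c + 2) = Q * c + Q + Q := by ring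
  have hr₂ : 2 ≤ r := by omega
  obtain ⟨g, hg⟩ : d ∣ Q - q * r + 2 * q :=
    hdvd.trans (dvd_add (Nat.dvd_sub hqQ (dvd_mul_right q r)) (dvd_mul_left q 2))
  have column : iterDiff (combPeriod (R := R) q r d s) (b + 1 + Q * c)
      (Q + 2 * q + e - (q * r + 1)) = 0 := by
    have binomial : ((Q + 2 * q + e - (q * r + 1)).choose e : R) = 0 := by
      refine choose_cast_eq_zero_of_mod_lt R p (v := β) (by omega) ?_
      rw [show Q + 2 * q + e - (q * r + 1) = d * g + (e - 1) by omega, ← hd, Nat.mul_add_mod,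
        Nat.mod_eq_of_lt (by omega)]
      omega
    rw [iterDiff_eq_of_support (y := q * r * s + 2 * q - d) (by omega) (by omega),
      show q * r * s + 2 * q - d - (b + 1 + Q * c) = Q + 2 * q + e - (q * r + 1) - e by omega,
      Nat.choose_symm (by omega), binomial, mul_zero, zero_mul]
    exact fun x _ _ _ => combPeriod_of_near_first hr₂ (by omega) (by omega)
  rw [skewDefect_pattern_eq_add p hr₂ hqr hd hdq hQ hs hb hqrQ (M := Q + 2 * q + e) (by omega)
    (by omega) (by omega), column, combPeriod_of_near_first hr₂ (by omega) (by omega),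
    mul_zero, add_zero]

omit [CharP R p] hp in
theorem iterDiff_of_zero_of_one {f : ℕ → R} {m j : ℕ} (hj : 1 ≤ j) (h₀ : f m = 0)
    (h₁ : ∀ x, m < x → x ≤ m + j → f x = 1) : iterDiff f m j = -1 := by
  obtain ⟨j, rfl⟩ := Nat.exists_eq_add_of_le' hj
  have split : iterDiff f m (j + 1) =
      iterDiff ((fun _ => 1) + Pi.single m (-1)) m (j + 1) := by
    refine iterDiff_congr fun x hx₁ hx₂ => ?_
    obtain rfl | hx := eq_or_ne x m
    · simp [h₀]
    · simp [hx, h₁ x (by omega) hx₂]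
  rw [split, iterDiff_add, iterDiff_const,
    iterDiff_single (e := j + 1) _ rfl le_rfl]
  simp

theorem iterDiff_combPeriod_lattice {h k : ℕ} (hq : q = p ^ h) (hrk : r = p ^ k) (hr : 2 ≤ r)
    (hdq : d < q) {x j : ℕ} (hj₁ : 1 ≤ j) (hjr : j < r) (hx : x + d = q * r + q) :
    iterDiff (combPeriod (R := R) q r d (s + 1)) x (q * (r * s + j)) = -(-1) ^ s := by
  have succ_period : q * r * (s + 1) = q * r * s + q * r := mul_add_one _ _
  have columns := iterDiff_dilate p (combPeriod (R := R) q r d (s + 1)) x h 0 0 (r * s + j)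
  have rows := iterDiff_dilate p (fun i => combPeriod (R := R) q r d (s + 1) (x + q * i)) 0 k j 0 s
  simp only [← hq, ← hrk, iterDiff_zero, mul_zero, add_zero, zero_add] at columns rows
  rw [columns, rows, iterDiff_eq_of_support (y := s) (by omega) (by omega),
    iterDiff_of_zero_of_one hj₁, Nat.sub_zero, Nat.choose_self, Nat.cast_one]
  · ring
  · rw [← mul_assoc]
    exact combPeriod_of_lt hr (by omega)
  · intro i hi₁ hi₂
    obtain ⟨y, rfl⟩ := Nat.exists_eq_add_of_le hi₁.le
    have : q * (r * s + y) = q * r * s + q * y := by ring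
    have : q * (y + 1) = q * y + q := mul_add_one _ _
    exact combPeriod_eq_one hdq (i := y + 1) (by omega) (by omega) (by omega)
  · intro t _ ht hne
    refine iterDiff_eq_zero fun i _ hi => combPeriod_of_lt hr ?_
    have : q * i + q ≤ q * (r * s) := by
      rw [← mul_add_one]
      refine Nat.mul_le_mul_left q ?_
      have := Nat.mul_le_mul_left r (show t + 1 ≤ s by omega)
      rw [mul_add_one] at this
      omega
    rw [← mul_assoc] at this
    omega

theorem skewDefect_pattern_first {h k : ℕ} (hq : q = p ^ h) (hrk : r = p ^ k) (hr : 2 ≤ r)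
    (hd : d = p ^ β) (hdq : d < q) {a b j : ℕ} (hj₁ : 1 ≤ j) (hjr : j < r)
    (hb : b + d = q * r * (s + 1) + q * j) (ha : a + 1 + d = q * r + q) :
    skewDefect (pattern (R := R) q r d (s + 1)) a b = 1 - (-1) ^ s := by
  have h2q : q * 2 ≤ q * r := Nat.mul_le_mul_left q hr
  have hqj : q * 1 ≤ q * j := Nat.mul_le_mul_left q hj₁
  have succ_period : q * r * (s + 1) = q * r * s + q * r := mul_add_one _ _
  have succ_tooth : q * (j + 1) = q * j + q := mul_add_one _ _
  obtain ⟨a, rfl⟩ := Nat.exists_eq_add_of_le (show q * r ≤ a by omega)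
  obtain ⟨b, rfl⟩ := Nat.exists_eq_add_of_le (show q * r ≤ b by omega)
  have window : iterDiff (combPeriod (R := R) q r d (s + 1)) (q * r + b + 1) (d + a) = 1 := by
    rw [show d + a = p ^ h - 1 by omega,
      iterDiff_window_eq p (y := q * r * (s + 1) + q * (j + 1) - d) (by omega) (by omega)]
    · exact combPeriod_eq_one hdq (i := j + 1) (by omega) (by omega) (by omega)
    · intro x hx₁ hx₂ hx₃
      have tooth : q * (r * (s + 1) + (j + 1)) = q * r * (s + 1) + q * (j + 1) := by ring
      exact combPeriod_of_near (a := r * (s + 1) + (j + 1)) (by omega) (by omega) (by omega)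
  rw [skewDefect_pattern p hr (n := h + k) (by rw [hq, hrk, pow_add]) hd hdq, window,
    show d + b = q * (r * s + j) by rw [mul_add, ← mul_assoc]; omega,
    iterDiff_combPeriod_lattice p hq hrk hr hdq hj₁ hjr (by omega)]
  ring

theorem skewDefect_pattern_first_shifted {h k : ℕ} (hq : q = p ^ h)
    (hrk : r = p ^ k) (hr : 2 ≤ r) (hd : d = p ^ β) (hdq : d < q) {a b j : ℕ}
    (hj₁ : 1 ≤ j) (hb : b + d = q * r * (s + 1) + q * j) (ha : a + 1 = q * r + q) :
    skewDefect (pattern (R := R) q r d (s + 1)) a b = 0 := by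
  have hd₀ : 0 < d := hd ▸ pow_pos hp.out.pos β
  have hqj : q * 1 ≤ q * j := Nat.mul_le_mul_left q hj₁
  have succ_period : q * r * (s + 1) = q * r * s + q * r := mul_add_one _ _
  obtain ⟨a, rfl⟩ := Nat.exists_eq_add_of_le (show q * r ≤ a by omega)
  obtain ⟨b, rfl⟩ := Nat.exists_eq_add_of_le (show q * r ≤ b by omega)
  have window : iterDiff (combPeriod (R := R) q r d (s + 1)) (q * r + b + 1) (d + a) = 0 := by
    have tooth : q * (r * (s + 1) + j) = q * r * (s + 1) + q * j := by ring
    have next : q * (r * (s + 1) + j + 1) = q * r * (s + 1) + q * j + q := by ring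
    rw [show d + a = p ^ h + (d - 1) by omega, iterDiff_prime_pow_add p, ← hq,
      iterDiff_eq_zero fun x _ _ => combPeriod_of_near (a := r * (s + 1) + j)
        (by omega) (by omega) (by omega),
      iterDiff_eq_zero fun x _ _ => combPeriod_of_near (a := r * (s + 1) + j + 1)
        (by omega) (by omega) (by omega), sub_zero]
  have lattice := iterDiff_dilate p (combPeriod (R := R) q r d (s + 1)) (q * r + a + 1) h 0 0
    (r * s + j)
  rw [← hq, mul_zero, add_zero, add_zero] at lattice
  rw [skewDefect_pattern p hr (n := h + k) (by rw [hq, hrk, pow_add]) hd hdq, window, add_zero,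
    show d + b = q * (r * s + j) by rw [mul_add, ← mul_assoc]; omega, lattice]
  refine iterDiff_eq_zero fun i _ _ => ?_
  have tooth : q * (r + 1 + i) = q * r + q + q * i := by ring
  exact combPeriod_of_near (a := r + 1 + i) (by omega) (by omega) (by omega)

end Defect

section Deviation

variable {R : Type*} [CommRing R] [IsDomain R]

namespace IsAdmissible

variable {ε g : ℕ → R} (hε : IsAdmissible ε) (h2 : (2 : R) ≠ 0) {i a b d : ℕ}
  (hbefore : Set.EqOn ε g (Set.Ico 1 i))
include hε h2 hbefore

theorem eq_of_odd (hi : i = a + b + 1) (hodd : Odd i) (hg : skewDefect g a b = 0) :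
    ε i = g i := by
  have sign : (-1 : R) ^ a = (-1) ^ b := by
    rw [neg_one_pow_congr (show Even a ↔ Even b by grind)]
  have deviation := skewDefect_eq_add_of_deviation (e := 0) hi (Nat.zero_le a) (Nat.zero_le b)
    fun x h₁ h₂ h₃ => hbefore ⟨h₁, by omega⟩
  rw [hε.skewDefect_eq_zero, hg, Nat.choose_zero_right, Nat.choose_zero_right, Nat.sub_zero,
    Nat.sub_zero, sign] at deviation
  have : 2 * (-1) ^ b * (ε i - g i) = 0 := by linear_combination -deviation
  exact sub_eq_zero.1 ((mul_eq_zero.1 this).resolve_left (by simp [h2]))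

theorem eq_of_even (hafter : Set.EqOn ε g (Set.Ioc i (i + d))) (hi : i + d = a + b + 1)
    (heven : Even i) (hd : Odd d) (hda : d ≤ a) (hdb : d ≤ b) (hg : skewDefect g a b = 0)
    (hchoose : (a.choose d : R) + b.choose d = -2) : ε i = g i := by
  have sign : (-1 : R) ^ (a - d) = (-1) ^ (b - d) := by
    rw [neg_one_pow_congr (show Even (a - d) ↔ Even (b - d) by grind)]
  have deviation := skewDefect_eq_add_of_deviation hi hda hdb fun x h₁ h₂ h₃ =>
    (lt_or_gt_of_ne h₃).elim (fun h => hbefore ⟨h₁, h⟩) fun h => hafter ⟨h, by omega⟩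
  rw [hε.skewDefect_eq_zero, hg, sign] at deviation
  have : 2 * (-1) ^ (b - d) * (ε i - g i) = 0 := by
    linear_combination deviation + (-1) ^ (b - d) * (ε i - g i) * hchoose
  exact sub_eq_zero.1 ((mul_eq_zero.1 this).resolve_left (by simp [h2]))

end IsAdmissible

end Deviation

theorem exists_eq_mul_add_mul_add {q r : ℕ} (hq : 0 < q) (hr : 0 < r) (y : ℕ) :
    ∃ v j f, j < r ∧ f < q ∧ y = q * r * v + q * j + f := by
  refine ⟨y / (q * r), y % (q * r) / q, y % (q * r) % q,
    Nat.div_lt_of_lt_mul (Nat.mod_lt y (mul_pos hq hr)), Nat.mod_lt _ hq, ?_⟩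
  rw [add_assoc, Nat.div_add_mod, Nat.div_add_mod]

theorem le_q_mul {q r s A : ℕ} (hA : r * (s + 1) + 2 ≤ A) : q * r * (s + 1) + 2 * q ≤ q * A := by
  calc q * r * (s + 1) + 2 * q = q * (r * (s + 1) + 2) := by ring
    _ ≤ q * A := Nat.mul_le_mul_left q hA

section Parameters

/-- The numerical data of `pattern q r d s`: the numbers `q`, `r` and `d` are powers of `p`, the
number `s` of periods between the two phase shifts is `p ^ l` times a number `c + 2` prime to `p`,
and `Q` is the length of `p ^ l` periods. -/
structure PatternParameters (p h k β l c q r d s Q : ℕ) : Prop where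
  ne_two : p ≠ 2
  q_eq : q = p ^ h
  r_eq : r = p ^ k
  d_eq : d = p ^ β
  s_eq : s = p ^ l * (c + 2)
  Q_eq : Q = q * r * p ^ l
  k_pos : 1 ≤ k
  β_lt : β < h
  not_dvd : ¬p ∣ c + 2

namespace PatternParameters

variable {p h k β l c q r d s Q : ℕ} (H : PatternParameters p h k β l c q r d s Q)
include H

theorem q_mul_r_eq : q * r = p ^ (h + k) := by rw [H.q_eq, H.r_eq, pow_add]

theorem Q_eq_pow : Q = p ^ (h + k + l) := by rw [H.Q_eq, H.q_mul_r_eq, ← pow_add]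

theorem q_mul_r_mul_s_eq : q * r * s = Q * (c + 2) := by
  rw [H.s_eq, H.Q_eq]
  ring

theorem d_mul_p_dvd_q : d * p ∣ q := by
  rw [H.d_eq, H.q_eq, ← pow_succ]
  exact pow_dvd_pow p H.β_lt

theorem q_dvd_Q : q ∣ Q := by
  rw [H.Q_eq, mul_assoc]
  exact dvd_mul_right q _

theorem d_mul_p_dvd_Q : d * p ∣ Q := H.d_mul_p_dvd_q.trans H.q_dvd_Q

theorem d_mul_p_dvd_q_mul_r_add_Q : d * p ∣ q * r + Q :=
  dvd_add (H.d_mul_p_dvd_q.mul_right r) H.d_mul_p_dvd_Q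

theorem d_mul_p_dvd_period_end (a v : ℕ) : d * p ∣ Q * a + q * r * v + 2 * q :=
  dvd_add (dvd_add (H.d_mul_p_dvd_Q.mul_right a) ((H.d_mul_p_dvd_q.mul_right r).mul_right v))
    (H.d_mul_p_dvd_q.mul_left 2)

theorem le_of_lt_period {v : ℕ} (h : q * r * v < Q + q * r) : v ≤ p ^ l := by
  rw [H.Q_eq, ← mul_add_one] at h
  exact Nat.lt_succ_iff.1 (lt_of_mul_lt_mul_left h (Nat.zero_le _))

theorem mul_add_period_le {v : ℕ} (hv : v < p ^ l) : q * r * v + q * r ≤ Q := by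
  rw [H.Q_eq, ← mul_add_one]
  exact Nat.mul_le_mul_left _ hv

variable [hp : Fact p.Prime]

theorem odd_p : Odd p := hp.out.odd_of_ne_two H.ne_two

theorem three_le_p : 3 ≤ p := by
  have := hp.out.two_le
  have := H.ne_two
  omega

theorem d_pos : 0 < d := H.d_eq ▸ pow_pos hp.out.pos β

theorem odd_d : Odd d := H.d_eq ▸ H.odd_p.pow

theorem three_mul_pow_le {t : ℕ} (ht : t < h) : 3 * p ^ t ≤ q := by
  rw [H.q_eq]
  calc 3 * p ^ t ≤ p * p ^ t := Nat.mul_le_mul_right _ H.three_le_p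
    _ = p ^ (t + 1) := by ring
    _ ≤ p ^ h := Nat.pow_le_pow_right hp.out.pos ht

theorem three_mul_d_le : 3 * d ≤ q := H.d_eq ▸ H.three_mul_pow_le H.β_lt

theorem three_le_r : 3 ≤ r := by
  rw [H.r_eq]
  exact H.three_le_p.trans (Nat.le_self_pow (Nat.one_le_iff_ne_zero.1 H.k_pos) p)

theorem three_mul_q_le : 3 * q ≤ q * r := by
  rw [mul_comm]
  exact Nat.mul_le_mul_left q H.three_le_r

theorem q_mul_r_le_Q : q * r ≤ Q := by
  rw [H.Q_eq]
  exact Nat.le_mul_of_pos_right _ (pow_pos hp.out.pos l)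

theorem exists_eq_succ : ∃ s', s = s' + 1 := Nat.exists_eq_add_of_le' <| by
  rw [H.s_eq]
  exact Nat.mul_pos (pow_pos hp.out.pos l) (Nat.succ_pos _)

theorem odd_of_add_d_eq {b : ℕ} (hb : b + d = q * r + Q) : Odd b := by
  have odd_qr : Odd (q * r) := H.q_mul_r_eq ▸ H.odd_p.pow
  have odd_Q : Odd Q := H.Q_eq_pow ▸ H.odd_p.pow
  have := H.odd_d
  grind

section Ring

variable {R : Type*} [CommRing R] [CharP R p]

omit hp in
theorem two_ne_zero [Nontrivial R] : (2 : R) ≠ 0 :=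
  Ring.two_ne_zero (CharP.eq R (ringChar.charP R) ‹CharP R p› ▸ H.ne_two)

variable (R) in
theorem choose_d_cast_eq_neg {a w e m : ℕ} (hw : d * p ∣ w) (he : e < d) (h : a + m * d = w + e) :
    (a.choose d : R) = -(m : R) := by
  obtain ⟨g, rfl⟩ := hw
  rw [H.d_eq] at he h ⊢
  exact choose_prime_pow_cast_eq_neg R p (w := g) he (by rw [h, pow_succ])

variable (R) in
theorem choose_d_cast_eq_neg_one {a : ℕ} (h : d * p ∣ a + d) : (a.choose d : R) = -1 := by
  simpa using H.choose_d_cast_eq_neg R (m := 1) h H.d_pos (by omega)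

variable (R) in
theorem choose_d_cast_eq_neg_one' {a : ℕ} (h : d * p ∣ a + 1) : (a.choose d : R) = -1 := by
  have := H.d_pos
  simpa using H.choose_d_cast_eq_neg R (m := 1) (e := d - 1) h (by omega) (by omega)

variable (R) in
theorem choose_d_sub_cast_eq_zero {a e f w : ℕ} (hw : d ∣ w) (he : 0 < e) (hef : e < f)
    (hfd : f ≤ d) (h : a + f = w) : (a.choose (d - e) : R) = 0 := by
  have := Nat.mod_lt a H.d_pos
  have residue : d ∣ a % d + f := by
    rwa [Nat.dvd_iff_mod_eq_zero, Nat.mod_add_mod, ← Nat.dvd_iff_mod_eq_zero, h]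
  have := Nat.eq_of_dvd_of_lt_two_mul (by omega) residue (by omega)
  have lucas := choose_cast_eq_zero_of_mod_lt R p (n := a) (e := d - e) (v := β)
  rw [← H.d_eq] at lucas
  exact lucas (by omega) (by omega)

theorem skewDefect_pattern_eq_zero {a b M : ℕ} (hb : b + d = q * r + Q)
    (ha : a + 1 + d = Q * (c + 1) + M) (hM : q * r < M) (hM' : M < Q + 2 * q) :
    skewDefect (pattern (R := R) q r d s) a b = 0 := by
  have := H.d_pos
  have := H.three_mul_d_le
  have := H.three_le_r
  exact MaxClass.skewDefect_pattern_eq_zero p (by omega) H.q_mul_r_eq H.d_eq (by omega) H.Q_eq_pow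
    H.q_mul_r_mul_s_eq hb H.q_mul_r_le_Q ha hM hM'

theorem skewDefect_pattern_eq_add_two {a b : ℕ} (hc : Odd c) (hb : b + d = q * r + Q)
    (ha : a + 1 + d = Q * (c + 2) + 2 * q) :
    skewDefect (pattern (R := R) q r d s) a b = c + 2 := by
  have := H.d_pos
  have := H.three_mul_d_le
  have := H.three_le_r
  exact MaxClass.skewDefect_pattern_eq_add_two p H.ne_two (by omega) H.q_mul_r_eq H.d_eq (by omega)
    H.Q_eq_pow H.q_mul_r_mul_s_eq hc hb H.q_mul_r_le_Q ha

theorem skewDefect_pattern_gap_eq_zero {a b e v : ℕ} (hv : 1 ≤ v) (hvl : v ≤ p ^ l)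
    (he₀ : 0 < e) (hed : e < d) (hb : b + d = q * r + Q)
    (ha : a + 1 + e = Q * (c + 1) + q * r * v + 2 * q) :
    skewDefect (pattern (R := R) q r d s) a b = 0 := by
  have := H.three_mul_d_le
  have := H.three_mul_q_le
  have : q * r * 1 ≤ q * r * v := Nat.mul_le_mul_left _ hv
  have : Q * (c + 2) = Q * (c + 1) + Q := mul_add_one _ _
  rcases hvl.lt_or_eq with hlt | rfl
  · have := H.mul_add_period_le hlt
    exact H.skewDefect_pattern_eq_zero (M := q * r * v + 2 * q - e + d) hb (by omega) (by omega)
      (by omega)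
  · rw [← H.Q_eq] at ha
    exact skewDefect_pattern_eq_zero_after p H.three_le_r H.q_mul_r_eq H.d_eq (by omega)
      (dvd_of_mul_right_dvd H.d_mul_p_dvd_q) (e := d - e) H.Q_eq_pow H.q_dvd_Q
      H.q_mul_r_mul_s_eq hb H.q_mul_r_le_Q (by omega) (by omega) (by omega)

end Ring

section Late

variable {R : Type*} [Zero R] [One R] {x A v : ℕ}

theorem pattern_tooth (hA : r * (s + 1) + 2 ≤ A) (hmod : A % r ≠ 1) (hx : x + 2 * d = q * A) :
    pattern (R := R) q r d s x = 1 := by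
  have := H.three_mul_d_le
  have := H.d_pos
  have := le_q_mul (q := q) hA
  rw [pattern_of_gt (by omega), hx, comb_mul_of_ne (by omega) hmod]

theorem pattern_near_tooth (hA : r * (s + 1) + 2 ≤ A) (h₁ : q * A < x + 2 * d + q)
    (h₂ : x + 2 * d < q * A + q) (hne : x + 2 * d ≠ q * A) :
    pattern (R := R) q r d s x = 0 := by
  have := H.three_mul_d_le
  have := le_q_mul (q := q) hA
  rw [pattern_of_gt (by omega), comb_of_near h₁ h₂ hne]

theorem pattern_gap (hv : 1 ≤ v) (h₁ : q * r * (s + 1) + q * r * v < x + 2 * d)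
    (h₂ : x + 2 * d < q * r * (s + 1) + q * r * v + 2 * q) :
    pattern (R := R) q r d s x = 0 := by
  have := H.three_le_r
  have := H.three_mul_q_le
  have := H.three_mul_d_le
  have : q * r * 1 ≤ q * r * v := Nat.mul_le_mul_left _ hv
  have start : q * r * (s + 1 + v) = q * r * (s + 1) + q * r * v := mul_add _ _ _
  rw [pattern_of_gt (by omega), comb_of_gap (b := s + 1 + v) (by omega) (by omega) (by omega)]

theorem pattern_gap_end (hx : x + 2 * d = q * r * (s + 1) + q * r * v + 2 * q) :
    pattern (R := R) q r d s x = 1 := by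
  have := H.three_le_r
  have : r * (s + 1 + v) = r * (s + 1) + r * v := mul_add _ _ _
  refine H.pattern_tooth (A := r * (s + 1 + v) + 2) (by omega) ?_ (by rw [hx]; ring)
  rw [Nat.mul_add_mod, Nat.mod_eq_of_lt (by omega)]
  omega

end Late

end PatternParameters

end Parameters

section Contradiction

variable {R : Type*} [CommRing R]

/-- The situation to be excluded: the sequence `ε` starts like `pattern q r d s`, up to the end of
the second constituent of length `2 * q - d`. -/
structure StartsLikePattern (p h k β l c q r d s Q : ℕ) (ε : ℕ → R) : Prop
    extends PatternParameters p h k β l c q r d s Q where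
  isAdmissible : IsAdmissible ε
  eq_pattern : ∀ x, 1 ≤ x → x + 2 * d ≤ q * r * (s + 1) + 2 * q → ε x = pattern q r d s x

namespace StartsLikePattern

variable {p h k β l c q r d s Q : ℕ} {ε : ℕ → R} [hp : Fact p.Prime]
  (H : StartsLikePattern p h k β l c q r d s Q ε)
include H

theorem eq_zero_of_lt {x : ℕ} (h₁ : 1 ≤ x) (h₂ : x < 2 * q) : ε x = 0 := by
  have := H.three_le_r
  have := H.three_mul_q_le
  have := H.three_mul_d_le
  have succ_period : q * r * (s + 1) = q * r * s + q * r := mul_add_one _ _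
  rw [H.eq_pattern x h₁ (by omega), pattern_of_le (by omega),
    comb_of_gap (b := 0) (by omega) (by omega) (by omega)]

theorem mul_eq_one {a : ℕ} (ha₁ : 2 ≤ a) (ha₂ : a ≤ 3) : ε (a * q) = 1 := by
  have := H.three_le_r
  have := H.three_mul_q_le
  have := H.three_mul_d_le
  have := H.d_pos
  have : a * q ≤ 3 * q := Nat.mul_le_mul_right q ha₂
  have : 2 * q ≤ a * q := Nat.mul_le_mul_right q ha₁
  have succ_period : q * r * (s + 1) = q * r * s + q * r := mul_add_one _ _
  have tooth : comb (R := R) q r (q * r * 0 + q * a) = 1 :=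
    comb_add_mul_of_two_le (by omega) ha₁ (by omega)
  rwa [H.eq_pattern _ (by omega) (by omega), pattern_of_le (by omega), mul_comm a,
    ← zero_add (q * a)]

section Teeth

variable {i : ℕ} (hbefore : Set.EqOn ε (pattern q r d s) (Set.Ico 1 i))
include hbefore

theorem eq_one_of_tooth {A N : ℕ} (hA : r * (s + 1) + 2 ≤ A) (hmod : A % r ≠ 1)
    (hN : N + 2 * d = q * A) (hNi : N < i) : ε N = 1 := by
  have := H.three_mul_d_le
  have := H.d_pos
  have := le_q_mul (q := q) hA
  exact (hbefore ⟨by omega, hNi⟩).trans (H.pattern_tooth hA hmod hN)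

theorem eq_zero_of_near_tooth {A x : ℕ} (hA : r * (s + 1) + 2 ≤ A) (h₁ : q * A < x + 2 * d + q)
    (h₂ : x + 2 * d < q * A + q) (hne : x + 2 * d ≠ q * A) (hxi : x < i) : ε x = 0 := by
  have := H.three_mul_d_le
  have := H.d_pos
  have := le_q_mul (q := q) hA
  exact (hbefore ⟨by omega, hxi⟩).trans (H.pattern_near_tooth hA h₁ h₂ hne)

theorem eq_zero_of_gap {v x : ℕ} (hv : 1 ≤ v) (h₁ : q * r * (s + 1) + q * r * v < x + 2 * d)
    (h₂ : x + 2 * d < q * r * (s + 1) + q * r * v + 2 * q) (hxi : x < i) : ε x = 0 := by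
  have := H.three_mul_d_le
  have := H.three_mul_q_le
  have : q * r * 1 ≤ q * r * v := Nat.mul_le_mul_left _ hv
  exact (hbefore ⟨by omega, hxi⟩).trans (H.pattern_gap hv h₁ h₂)

theorem eq_one_of_gap_start {v N : ℕ} (hv : 1 ≤ v)
    (hN : N + 2 * d = q * r * (s + 1) + q * r * v) (hNi : N < i) : ε N = 1 := by
  have := H.three_le_r
  have : r * (s + 1 + v) = r * (s + 1) + r * v := mul_add _ _ _
  have : r * 1 ≤ r * v := Nat.mul_le_mul_left _ hv
  exact H.eq_one_of_tooth hbefore (A := r * (s + 1 + v)) (by omega) (by simp)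
    (by rw [hN]; ring) hNi

theorem eq_zero_before_gap_start {v N : ℕ} (hv : 1 ≤ v)
    (hN : N + 2 * d = q * r * (s + 1) + q * r * v) (hNi : N < i) :
    ∀ x, N < x + q → x < N → ε x = 0 := by
  have := H.three_le_r
  have : r * (s + 1 + v) = r * (s + 1) + r * v := mul_add _ _ _
  have : r * 1 ≤ r * v := Nat.mul_le_mul_left _ hv
  have tooth : q * (r * (s + 1 + v)) = q * r * (s + 1) + q * r * v := by ring
  exact fun x h₁ h₂ => H.eq_zero_of_near_tooth hbefore (A := r * (s + 1 + v)) (by omega)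
    (by omega) (by omega) (by omega) (by omega)

end Teeth

variable [IsDomain R] [CharP R p]

/-- Otherwise the skew-symmetry of the initial segment already fails. -/
theorem odd_c : Odd c := by
  have := H.three_le_r
  have := H.three_mul_d_le
  have := H.d_pos
  obtain ⟨s', rfl⟩ := H.exists_eq_succ
  have succ_period : q * r * (s' + 1 + 1) = q * r * (s' + 1) + q * r := mul_add_one _ _
  have defect := skewDefect_pattern_first (R := R) p (s := s') H.q_eq H.r_eq (by omega) H.d_eq
    (by omega) (a := q * r + q - d - 1) (b := q * r * (s' + 1) + q * 1 - d) le_rfl (by omega)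
    (by omega) (by omega)
  rw [← skewDefect_congr fun x h₁ h₂ => H.eq_pattern x h₁ (by omega),
    H.isAdmissible.skewDefect_eq_zero] at defect
  have even_s' : Even s' := by
    by_contra odd_s'
    rw [(Nat.not_even_iff_odd.1 odd_s').neg_one_pow] at defect
    exact H.two_ne_zero (R := R) (by linear_combination -defect)
  have odd_s := even_s'.add_one
  rw [H.s_eq, Nat.odd_mul] at odd_s
  exact (Nat.odd_add.1 odd_s.2).2 even_two

theorem zero_after_of_zero_before {N : ℕ} (hN₁ : 1 ≤ N) (hN : ε N ≠ 0)
    (hbefore : ∀ x, N < x + q → x < N → ε x = 0) : ∀ x, N < x → x < N + q → ε x = 0 := by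
  rw [H.q_eq] at hbefore ⊢
  exact H.isAdmissible.zero_after_of_zero_before
    (fun x h₁ h₂ => H.eq_zero_of_lt h₁ (H.q_eq ▸ h₂)) hN₁ hN hbefore

theorem exists_eq_pow_of_short_gap {N i e : ℕ} (hN₁ : 1 ≤ N) (hN : ε N ≠ 0)
    (hbefore : ∀ x, N < x + q → x < N → ε x = 0) (he₀ : 0 < e) (he : e < q)
    (hi : i + e = N + 2 * q) (hεi : ε i ≠ 0) (hgap : ∀ x, N < x → x < i → ε x = 0) :
    ∃ t, t < h ∧ e = p ^ t := by
  rw [H.q_eq] at hbefore he hi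
  exact H.isAdmissible.exists_eq_pow_of_short_gap
    (fun x h₁ h₂ => H.eq_zero_of_lt h₁ (H.q_eq ▸ h₂)) hN₁ hN hbefore he₀ he hi hεi hgap

theorem eq_one_of_full_gap {N : ℕ} (hN₁ : 1 ≤ N) (hN : ε N = 1)
    (hgap : ∀ x, N < x → x < N + 2 * q → ε x = 0) : ε (N + 2 * q) = 1 := by
  have h2q := H.mul_eq_one (a := 2) le_rfl (by omega)
  rw [H.q_eq] at hgap h2q ⊢
  exact H.isAdmissible.eq_one_of_full_gap h2q hN₁ hN hgap

theorem eq_one_of_short_gap {N i : ℕ} (hN₁ : 1 ≤ N) (hN : ε N = 1)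
    (hbefore : ∀ x, N < x + q → x < N → ε x = 0) (hi : i + d = N + 2 * q) (hεi : ε i ≠ 0)
    (hgap : ∀ x, N < x → x < i → ε x = 0) : ε i = 1 ∧ ε (i + q) = 1 := by
  have := H.three_mul_d_le
  have := H.d_pos
  have hd : d < p ^ h := H.q_eq ▸ (by omega : d < q)
  have h2q := H.mul_eq_one (a := 2) le_rfl (by omega)
  have h3q := H.mul_eq_one (a := 3) (by omega) le_rfl
  rw [H.q_eq] at hbefore h2q h3q hi ⊢
  exact H.isAdmissible.eq_one_of_short_gap (fun x h₁ h₂ => H.eq_zero_of_lt h₁ (H.q_eq ▸ h₂))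
    h2q h3q hN₁ hN H.d_pos hd hi hεi hbefore hgap

section Continuation

variable {i : ℕ} (hbefore : Set.EqOn ε (pattern q r d s) (Set.Ico 1 i))
include hbefore

theorem eq_zero_after_tooth {A N x : ℕ} (hA : r * (s + 1) + 2 ≤ A) (hmod : A % r ≠ 1)
    (hN : N + 2 * d = q * A) (h₁ : N < x) (h₂ : x < N + q) (hxi : x ≤ i) : ε x = 0 := by
  have := H.three_mul_d_le
  have := le_q_mul (q := q) hA
  refine H.zero_after_of_zero_before (N := N) (by omega) ?_ ?_ x h₁ h₂
  · rw [H.eq_one_of_tooth hbefore hA hmod hN (by omega)]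
    exact one_ne_zero
  · exact fun y h₃ h₄ =>
      H.eq_zero_of_near_tooth hbefore hA (by omega) (by omega) (by omega) (by omega)

-- The first vanishing defect determines `ε i` when `i` is odd, the second one when `i` is even.
theorem eq_pattern_of_skewDefect {a b : ℕ}
    (hafter : Set.EqOn ε (pattern q r d s) (Set.Ioc i (i + d))) (hi : i = a + b + 1)
    (ha : d * p ∣ a + d + 1) (hb : d * p ∣ b + d)
    (h₁ : skewDefect (pattern (R := R) q r d s) a b = 0)
    (h₂ : skewDefect (pattern (R := R) q r d s) (a + d) b = 0) : ε i = pattern q r d s i := by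
  rcases Nat.even_or_odd i with heven | hodd
  · have hdb : d ≤ b := by
      have := H.d_pos
      have := Nat.le_of_dvd (by omega) hb
      have : d * 3 ≤ d * p := Nat.mul_le_mul_left d H.three_le_p
      omega
    refine H.isAdmissible.eq_of_even H.two_ne_zero hbefore hafter (by omega) heven H.odd_d
      (Nat.le_add_left d a) hdb h₂ ?_
    rw [H.choose_d_cast_eq_neg_one' R ha, H.choose_d_cast_eq_neg_one R hb]
    ring
  · exact H.isAdmissible.eq_of_odd H.two_ne_zero hbefore hi hodd h₁

omit [IsDomain R] in
theorem iterDiff_column_eq_two {m j : ℕ} (hi : i + 3 * d = q * r * (s + 1) + Q + 2 * q)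
    (hm : m + 2 * d = q * r + Q + 2 * q) (hj : j ≤ c) :
    iterDiff ε (m + Q * j) (q - d - 1) = 2 := by
  have := H.three_mul_d_le
  have := H.d_pos
  have := H.three_le_r
  have := H.three_mul_q_le
  have := H.q_mul_r_le_Q
  have : Q * j ≤ Q * c := Nat.mul_le_mul_left Q hj
  have : Q * (c + 2) = Q * c + Q + Q := by ring
  have succ_period : q * r * (s + 1) = Q * (c + 2) + q * r := by
    rw [mul_add_one, H.q_mul_r_mul_s_eq]
  have tooth : q * (r * (1 + p ^ l * (j + 1)) + 2) = q * r + Q + Q * j + 2 * q := by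
    rw [H.Q_eq]
    ring
  have eq_comb (x : ℕ) (h₁ : m + Q * j ≤ x) (h₂ : x ≤ m + Q * j + (q - d - 1)) :
      ε x = comb q r (x + d) := by
    rw [hbefore ⟨by omega, by omega⟩, pattern_of_mid (by omega) (by omega)]
  rw [iterDiff_eq_of_support (y := m + Q * j + d) (by omega) (by omega), Nat.add_sub_cancel_left,
    H.odd_d.neg_one_pow, H.choose_d_cast_eq_neg R (w := q) (e := d - 1) (m := 2) H.d_mul_p_dvd_q
      (by omega) (by omega), eq_comb _ (by omega) (by omega),
    show m + Q * j + d + d = q * (r * (1 + p ^ l * (j + 1)) + 2) by omega,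
    comb_mul_of_ne (by omega) (by rw [Nat.mul_add_mod, Nat.mod_eq_of_lt (by omega)]; omega)]
  · push_cast
    ring
  · intro x h₁ h₂ hne
    rw [eq_comb x h₁ h₂]
    exact comb_of_near (a := r * (1 + p ^ l * (j + 1)) + 2) (by omega) (by omega) (by omega)

omit [IsDomain R] [CharP R p] in
theorem iterDiff_column_eq_one {m : ℕ} (hi : i + 3 * d = q * r * (s + 1) + Q + 2 * q)
    (hm : m + 2 * d = q * r + Q + 2 * q) :
    iterDiff ε (m + Q * (c + 1)) (q - d - 1) = 1 := by
  have := H.three_mul_d_le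
  have := H.d_pos
  have := H.three_le_r
  have := H.three_mul_q_le
  have := H.q_mul_r_le_Q
  have : Q * (c + 2) = Q * (c + 1) + Q := mul_add_one _ _
  have succ_period : q * r * (s + 1) = Q * (c + 2) + q * r := by
    rw [mul_add_one, H.q_mul_r_mul_s_eq]
  have tooth : q * (r * (s + 1) + 2) = q * r * (s + 1) + 2 * q := by ring
  rw [iterDiff_eq_of_support (y := m + Q * (c + 1)) (by omega) (by omega), Nat.sub_self,
    H.eq_one_of_tooth hbefore (A := r * (s + 1) + 2) le_rfl
      (by rw [Nat.mul_add_mod, Nat.mod_eq_of_lt (by omega)]; omega) (by omega) (by omega)]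
  · simp
  · intro x h₁ h₂ hne
    exact H.eq_zero_of_near_tooth hbefore (A := r * (s + 1) + 2) le_rfl (by omega) (by omega)
      (by omega) (by omega)

/-- The columns `2, …, 2, 1, 0` have difference `-c = 1`, and the weights of the two zeros add up
to the tooth following the third shift. -/
theorem false_of_third_shift (hi : i + 3 * d = q * r * (s + 1) + Q + 2 * q)
    (hafter : ∀ x, i < x → x < i + q → ε x = 0) (hlast : ε (i + q) = 1)
    (hc : (c + 2 : R) = 1) : False := by
  have := H.three_mul_d_le
  have := H.d_pos
  have := H.three_le_r
  have := H.three_mul_q_le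
  have := H.q_mul_r_le_Q
  have : Q * (c + 2) = Q * c + Q + Q := by ring
  have hs := H.q_mul_r_mul_s_eq
  have succ_period : q * r * (s + 1) = q * r * s + q * r := mul_add_one _ _
  obtain ⟨m, hm⟩ : ∃ m, m + 2 * d = q * r + Q + 2 * q := ⟨q * r + Q + 2 * q - 2 * d, by omega⟩
  obtain ⟨k', hk'⟩ : ∃ k', k' + d = q * r * s + q := ⟨q * r * s + q - d, by omega⟩
  have εm : ε m = 0 := by
    have tooth : q * (r + r * p ^ l + 1) = q * r + Q + q := by
      rw [H.Q_eq]
      ring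
    rw [hbefore ⟨by omega, by omega⟩, pattern_of_mid (by omega) (by omega),
      comb_of_between (a := r + r * p ^ l + 1) (by omega) (by omega)]
  have εk : ε k' = 0 := by
    rw [hbefore ⟨by omega, by omega⟩, pattern_of_mid (by omega) (by omega),
      comb_of_gap (b := s) (by omega) (by omega) (by omega)]
  have last_column : iterDiff ε (m + Q * (c + 2)) (q - d - 1) = 0 :=
    iterDiff_eq_zero fun x _ _ => hafter x (by omega) (by omega)
  have difference : iterDiff ε m (k' - 1) = 1 := by
    have columns := iterDiff_dilate p ε m (h + k + l) (q - d - 1) 0 (c + 2)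
    simp only [← H.Q_eq_pow, mul_zero, add_zero] at columns
    rw [show k' - 1 = Q * (c + 2) + (q - d - 1) by omega, columns,
      iterDiff_of_two_of_one_of_zero (fun j => H.iterDiff_column_eq_two hbefore hi hm)
        (H.iterDiff_column_eq_one hbefore hi hm) last_column, H.odd_c.neg_one_pow]
    linear_combination -hc
  have tooth := H.isAdmissible.eq_zero_of_zero_zero (m := m) (k := k') (by omega) (by omega) εm εk
    (by rw [difference]; exact one_ne_zero)
  rw [show m + k' = i + q by omega, hlast] at tooth
  exact one_ne_zero tooth

theorem eq_zero_after_of_gap {e v : ℕ} (hv : 1 ≤ v) (heq : e ≤ q)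
    (hi : i + e + 2 * d = q * r * (s + 1) + q * r * v + 2 * q) (hεi : ε i ≠ 0) :
    ∀ x, i < x → x < i + q → ε x = 0 := by
  have := H.three_mul_d_le
  have := H.d_pos
  exact H.zero_after_of_zero_before (by omega) hεi fun x h₁ h₂ =>
    H.eq_zero_of_gap hbefore hv (by omega) (by omega) h₂

/-- Up to weight `i + d`, the sequence deviates from the pattern only at `i` and at the end `i + e`
of the gap. -/
theorem skewDefect_pattern_of_gap {a b e v : ℕ} (hv : 1 ≤ v) (he₀ : 0 < e) (he : e ≤ d)
    (he_odd : Odd e) (hi : i + e + 2 * d = q * r * (s + 1) + q * r * v + 2 * q) (hεi : ε i ≠ 0)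
    (heven : Even i) (ha : Odd a) (hab : i + d = a + b + 1) (hda : d ≤ a) (hdb : d ≤ b) :
    skewDefect (pattern (R := R) q r d s) a b =
      -(b.choose (d - e) + a.choose (d - e) : R) - (b.choose d + a.choose d : R) * ε i := by
  have := H.three_mul_d_le
  have hafter := H.eq_zero_after_of_gap hbefore hv (by omega) hi hεi
  have end_eq : pattern (R := R) q r d s (i + e) = 1 := H.pattern_gap_end (v := v) (by omega)
  have i_eq : pattern (R := R) q r d s i = 0 := H.pattern_gap hv (by omega) (by omega)
  have hd := H.odd_d
  set g : ℕ → R := Function.update (pattern q r d s) (i + e) 0 with hg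
  have at_i : skewDefect ε a b = skewDefect g a b +
      ((-1) ^ (b - d) * (b.choose d : R) + (-1) ^ (a - d) * (a.choose d : R)) * (ε i - g i) := by
    refine skewDefect_eq_add_of_deviation hab hda hdb fun x h₁ h₂ hne => ?_
    rcases lt_or_gt_of_ne hne with hlt | hgt
    · rw [hg, Function.update_of_ne (by omega), hbefore ⟨h₁, hlt⟩]
    · rw [hafter x hgt (by omega)]
      obtain rfl | hxe := eq_or_ne x (i + e)
      · rw [hg, Function.update_self]
      · have tooth : q * (r * (s + 1 + v) + 2) = q * r * (s + 1) + q * r * v + 2 * q := by ring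
        have : r * (s + 1 + v) = r * (s + 1) + r * v := mul_add _ _ _
        rw [hg, Function.update_of_ne hxe, H.pattern_near_tooth (A := r * (s + 1 + v) + 2)
          (by omega) (by omega) (by omega) (by omega)]
  have at_end : skewDefect g a b = skewDefect (pattern q r d s) a b +
      ((-1) ^ (b - (d - e)) * (b.choose (d - e) : R) +
        (-1) ^ (a - (d - e)) * (a.choose (d - e) : R)) *
        (g (i + e) - pattern q r d s (i + e)) :=
    skewDefect_eq_add_of_deviation (by omega) (by omega) (by omega) fun x _ _ hne =>
      Function.update_of_ne hne _ _
  rw [H.isAdmissible.skewDefect_eq_zero, at_end, end_eq, hg, Function.update_self,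
    Function.update_of_ne (by omega), i_eq, Even.neg_one_pow (n := b - d) (by grind),
    Even.neg_one_pow (n := a - d) (by grind), Odd.neg_one_pow (n := b - (d - e)) (by grind),
    Odd.neg_one_pow (n := a - (d - e)) (by grind)] at at_i
  linear_combination -at_i

theorem eq_zero_of_gap_of_odd {e v : ℕ} (hv : 1 ≤ v) (hvQ : q * r * v ≤ Q) (he₀ : 0 < e)
    (heq : e ≤ q) (hi : i + e + 2 * d = q * r * (s + 1) + q * r * v + 2 * q) (hodd : Odd i) :
    ε i = 0 := by
  have := H.three_mul_d_le
  have := H.d_pos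
  have := H.three_mul_q_le
  have := H.q_mul_r_le_Q
  have : q * r * 1 ≤ q * r * v := Nat.mul_le_mul_left _ hv
  have : Q * (c + 2) = Q * (c + 1) + Q := mul_add_one _ _
  have succ_period : q * r * (s + 1) = Q * (c + 2) + q * r := by
    rw [mul_add_one, H.q_mul_r_mul_s_eq]
  rw [← H.pattern_gap (R := R) (x := i) hv (by omega) (by omega)]
  refine H.isAdmissible.eq_of_odd H.two_ne_zero hbefore
    (a := Q * (c + 1) + (q * r * v + 2 * q - e) - 1 - d) (b := q * r + Q - d) (by omega) hodd ?_
  exact H.skewDefect_pattern_eq_zero (M := q * r * v + 2 * q - e) (by omega) (by omega) (by omega)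
    (by omega)

theorem eq_zero_of_gap_of_lt {e v : ℕ} (hv : 1 ≤ v) (hvQ : q * r * v ≤ Q) (hde : d < e)
    (hdvd : d * p ∣ e) (heq : e ≤ q)
    (hi : i + e + 2 * d = q * r * (s + 1) + q * r * v + 2 * q) : ε i = 0 := by
  have := H.three_mul_d_le
  have := H.d_pos
  have := H.three_mul_q_le
  have := H.q_mul_r_le_Q
  have : q * r * 1 ≤ q * r * v := Nat.mul_le_mul_left _ hv
  have : Q * (c + 2) = Q * (c + 1) + Q := mul_add_one _ _
  have succ_period : q * r * (s + 1) = Q * (c + 2) + q * r := by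
    rw [mul_add_one, H.q_mul_r_mul_s_eq]
  have i_eq : pattern (R := R) q r d s i = 0 := H.pattern_gap hv (by omega) (by omega)
  by_contra hεi
  have hafter := H.eq_zero_after_of_gap hbefore hv heq hi hεi
  obtain ⟨a, ha⟩ : ∃ a, a + 1 + d = Q * (c + 1) + (q * r * v + 2 * q - e) :=
    ⟨Q * (c + 1) + (q * r * v + 2 * q - e) - 1 - d, by omega⟩
  refine hεi (i_eq ▸ H.eq_pattern_of_skewDefect hbefore (a := a) (b := q * r + Q - d)
    ?_ (by omega) ?_ ?_ ?_ ?_)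
  · rintro x ⟨h₁, h₂⟩
    rw [hafter x h₁ (by omega), H.pattern_gap hv (by omega) (by omega)]
  · rw [show a + d + 1 = Q * (c + 1) + q * r * v + 2 * q - e by omega]
    exact Nat.dvd_sub (H.d_mul_p_dvd_period_end _ _) hdvd
  · rw [Nat.sub_add_cancel (by omega)]
    exact H.d_mul_p_dvd_q_mul_r_add_Q
  · exact H.skewDefect_pattern_eq_zero (by omega) ha (by omega) (by omega)
  · exact H.skewDefect_pattern_eq_zero (M := q * r * v + 2 * q - e + d) (by omega) (by omega)
      (by omega) (by omega)

theorem eq_zero_of_gap_of_pow_lt {t v : ℕ} (ht : t < β) (hv : 1 ≤ v) (hvl : v ≤ p ^ l)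
    (hi : i + p ^ t + 2 * d = q * r * (s + 1) + q * r * v + 2 * q) (heven : Even i) :
    ε i = 0 := by
  have := H.three_mul_d_le
  have := H.three_mul_q_le
  have := H.q_mul_r_le_Q
  have he₀ : 0 < p ^ t := pow_pos hp.out.pos t
  have hed : p ^ t < d := H.d_eq ▸ Nat.pow_lt_pow_right hp.out.one_lt ht
  have : q * r * 1 ≤ q * r * v := Nat.mul_le_mul_left _ hv
  have : Q * (c + 2) = Q * (c + 1) + Q := mul_add_one _ _
  have succ_period : q * r * (s + 1) = Q * (c + 2) + q * r := by
    rw [mul_add_one, H.q_mul_r_mul_s_eq]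
  obtain ⟨a, ha⟩ : ∃ a, a + 1 + p ^ t = Q * (c + 1) + q * r * v + 2 * q :=
    ⟨Q * (c + 1) + q * r * v + 2 * q - 1 - p ^ t, by omega⟩
  obtain ⟨b, hb⟩ : ∃ b, b + d = q * r + Q := ⟨q * r + Q - d, by omega⟩
  have odd_b := H.odd_of_add_d_eq hb
  by_contra hεi
  have defect := H.skewDefect_pattern_of_gap hbefore (a := a) (b := b) hv he₀ hed.le H.odd_p.pow hi
    hεi heven (by grind [H.odd_d]) (by omega) (by omega) (by omega)
  have dvd_a := H.d_mul_p_dvd_period_end (c + 1) v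
  have dvd_b := H.d_mul_p_dvd_q_mul_r_add_Q
  rw [H.skewDefect_pattern_gap_eq_zero hv hvl he₀ hed hb ha,
    H.choose_d_cast_eq_neg_one R (hb ▸ dvd_b),
    H.choose_d_cast_eq_neg R dvd_a (a := a) (e := d - 1 - p ^ t) (m := 1) (by omega) (by omega),
    H.choose_d_sub_cast_eq_zero R (dvd_of_mul_right_dvd dvd_b) he₀ hed le_rfl hb,
    H.choose_d_sub_cast_eq_zero R (dvd_of_mul_right_dvd dvd_a) he₀ (Nat.lt_add_one _) hed
      (by omega)] at defect
  have : 2 * ε i = 0 := by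
    push_cast at defect
    linear_combination -defect
  exact hεi ((mul_eq_zero.1 this).resolve_left H.two_ne_zero)

theorem eq_one_of_gap_of_eq_d {v : ℕ} (hv : 1 ≤ v)
    (hi : i + 3 * d = q * r * (s + 1) + q * r * v + 2 * q) (hεi : ε i ≠ 0) :
    ε i = 1 ∧ ε (i + q) = 1 := by
  have := H.three_mul_d_le
  have := H.d_pos
  have := H.three_mul_q_le
  have : q * r * 1 ≤ q * r * v := Nat.mul_le_mul_left _ hv
  obtain ⟨N, hN⟩ : ∃ N, N + 2 * d = q * r * (s + 1) + q * r * v :=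
    ⟨q * r * (s + 1) + q * r * v - 2 * d, by omega⟩
  exact H.eq_one_of_short_gap (N := N) (by omega)
    (H.eq_one_of_gap_start hbefore hv hN (by omega))
    (H.eq_zero_before_gap_start hbefore hv hN (by omega)) (by omega) hεi
    fun x h₁ h₂ => H.eq_zero_of_gap hbefore hv (by omega) (by omega) h₂

theorem eq_zero_of_gap_of_eq_d {v : ℕ} (hv : 1 ≤ v) (hvl : v ≤ p ^ l)
    (hi : i + 3 * d = q * r * (s + 1) + q * r * v + 2 * q) (heven : Even i) : ε i = 0 := by
  have := H.three_mul_d_le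
  have := H.d_pos
  have := H.three_mul_q_le
  have := H.q_mul_r_le_Q
  have : q * r * 1 ≤ q * r * v := Nat.mul_le_mul_left _ hv
  have : Q * (c + 2) = Q * (c + 1) + Q := mul_add_one _ _
  have succ_period : q * r * (s + 1) = Q * (c + 2) + q * r := by
    rw [mul_add_one, H.q_mul_r_mul_s_eq]
  obtain ⟨a, ha⟩ : ∃ a, a + 1 + d = Q * (c + 1) + q * r * v + 2 * q :=
    ⟨Q * (c + 1) + q * r * v + 2 * q - 1 - d, by omega⟩
  obtain ⟨b, hb⟩ : ∃ b, b + d = q * r + Q := ⟨q * r + Q - d, by omega⟩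
  have odd_b := H.odd_of_add_d_eq hb
  by_contra hεi
  have hi' : i + d + 2 * d = q * r * (s + 1) + q * r * v + 2 * q := by omega
  obtain ⟨i_eq, last⟩ := H.eq_one_of_gap_of_eq_d hbefore hv hi hεi
  have defect := H.skewDefect_pattern_of_gap hbefore (a := a) (b := b) hv H.d_pos le_rfl H.odd_d
    hi' hεi heven (by grind [H.odd_d]) (by omega) (by omega) (by omega)
  rw [H.choose_d_cast_eq_neg_one R (hb ▸ H.d_mul_p_dvd_q_mul_r_add_Q),
    H.choose_d_cast_eq_neg R (H.d_mul_p_dvd_period_end (c + 1) v) (a := a) (e := d - 1) (m := 2)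
      (by omega) (by omega), Nat.sub_self, Nat.choose_zero_right, Nat.choose_zero_right, i_eq]
    at defect
  push_cast at defect
  rcases hvl.lt_or_eq with hlt | rfl
  · have := H.mul_add_period_le hlt
    rw [H.skewDefect_pattern_eq_zero (M := q * r * v + 2 * q) hb (by omega) (by omega)
      (by omega)] at defect
    exact one_ne_zero (α := R) (by linear_combination -defect)
  · have hafter := H.eq_zero_after_of_gap hbefore hv (by omega) hi' hεi
    rw [← H.Q_eq] at ha hi
    rw [H.skewDefect_pattern_eq_add_two H.odd_c hb (by omega)] at defect
    exact H.false_of_third_shift hbefore hi hafter last (by linear_combination defect)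

theorem eq_zero_of_gap_end {t v : ℕ} (ht : t ≤ h) (hv : 1 ≤ v) (hvl : v ≤ p ^ l)
    (hi : i + p ^ t + 2 * d = q * r * (s + 1) + q * r * v + 2 * q) : ε i = 0 := by
  have he₀ : 0 < p ^ t := pow_pos hp.out.pos t
  have heq : p ^ t ≤ q := H.q_eq ▸ Nat.pow_le_pow_right hp.out.pos ht
  have hvQ : q * r * v ≤ Q := H.Q_eq ▸ Nat.mul_le_mul_left _ hvl
  rcases Nat.even_or_odd i with heven | hodd
  · rcases lt_trichotomy t β with hlt | rfl | hgt
    · exact H.eq_zero_of_gap_of_pow_lt hbefore hlt hv hvl hi heven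
    · exact H.eq_zero_of_gap_of_eq_d hbefore hv hvl (by rw [← hi, ← H.d_eq]; ring) heven
    · refine H.eq_zero_of_gap_of_lt hbefore hv hvQ ?_ ?_ heq hi
      · exact H.d_eq ▸ Nat.pow_lt_pow_right hp.out.one_lt hgt
      · exact H.d_eq ▸ pow_succ p β ▸ pow_dvd_pow p hgt
  · exact H.eq_zero_of_gap_of_odd hbefore hv hvQ he₀ heq hi hodd

theorem eq_pattern_in_gap {v N : ℕ} (hv : 1 ≤ v) (hvl : v ≤ p ^ l)
    (hN : N + 2 * d = q * r * (s + 1) + q * r * v) (h₁ : N + q ≤ i) (h₂ : i ≤ N + 2 * q) :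
    ε i = pattern q r d s i := by
  have := H.three_mul_d_le
  have := H.d_pos
  have := H.three_mul_q_le
  have : q * r * 1 ≤ q * r * v := Nat.mul_le_mul_left _ hv
  have N_eq := H.eq_one_of_gap_start hbefore hv hN (by omega)
  have before := H.eq_zero_before_gap_start hbefore hv hN (by omega)
  have gap (x : ℕ) (h₁ : N < x) (h₂ : x < N + 2 * q) (hxi : x < i) : ε x = 0 :=
    H.eq_zero_of_gap hbefore hv (by omega) (by omega) hxi
  obtain rfl | hlt := h₂.eq_or_lt
  · rw [H.eq_one_of_full_gap (by omega) N_eq fun x h₁ h₂ => gap x h₁ h₂ h₂,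
      H.pattern_gap_end (v := v) (by omega)]
  rw [H.pattern_gap hv (by omega) (by omega)]
  obtain rfl | hgt := h₁.eq_or_lt
  · exact H.eq_zero_of_gap_end hbefore le_rfl hv hvl (by rw [← H.q_eq]; omega)
  by_contra hεi
  obtain ⟨e, he⟩ : ∃ e, i + e = N + 2 * q := ⟨N + 2 * q - i, by omega⟩
  obtain ⟨t, ht, rfl⟩ := H.exists_eq_pow_of_short_gap (by omega) (N_eq ▸ one_ne_zero) before
    (e := e) (by omega) (by omega) he hεi fun x h₁ h₂ => gap x h₁ (by omega) h₂
  exact hεi (H.eq_zero_of_gap_end hbefore ht.le hv hvl (by omega))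

theorem eq_zero_after_of_tooth {A N : ℕ} (hA : r * (s + 1) + 2 ≤ A) (hmod : A % r ≠ 1)
    (hN : N + 2 * d = q * A) (hi : i = N + q) : ∀ x, i < x → x ≤ i + d → ε x = 0 := by
  have := H.three_mul_d_le
  have := H.d_pos
  have := le_q_mul (q := q) hA
  have zero_before (x : ℕ) (h₁ : N < x) (h₂ : x < i) : ε x = 0 :=
    H.eq_zero_after_tooth hbefore hA hmod hN h₁ (by omega) h₂.le
  intro x h₁ h₂
  by_cases hεi : ε i = 0
  · induction x using Nat.strong_induction_on with
    | _ x ih =>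
      by_contra hεx
      have gap (y : ℕ) (h₃ : N < y) (h₄ : y < x) : ε y = 0 := by
        rcases lt_trichotomy y i with hlt | rfl | hgt
        · exact zero_before y h₃ hlt
        · exact hεi
        · exact ih y h₄ hgt (by omega)
      obtain ⟨e, he⟩ : ∃ e, x + e = N + 2 * q := ⟨N + 2 * q - x, by omega⟩
      obtain ⟨t, ht, rfl⟩ := H.exists_eq_pow_of_short_gap (N := N) (e := e) (by omega)
        (H.eq_one_of_tooth hbefore hA hmod hN (by omega) ▸ one_ne_zero)
        (fun y h₃ h₄ => H.eq_zero_of_near_tooth hbefore hA (by omega) (by omega) (by omega)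
          (by omega)) (by omega) (by omega) he hεx gap
      have := H.three_mul_pow_le ht
      omega
  · exact H.zero_after_of_zero_before (by omega) hεi
      (fun y h₃ h₄ => zero_before y (by omega) h₄) x h₁ (by omega)

omit hbefore in
theorem skewDefect_pattern_of_mid_first {a b j : ℕ} (hj₁ : 1 ≤ j) (hjr : j < r)
    (ha : a + 1 + d = q * r + q) (hb : b + d = q * r * s + q * j) :
    skewDefect (pattern (R := R) q r d s) a b = 0 ∧
      skewDefect (pattern (R := R) q r d s) (a + d) b = 0 := by
  have := H.three_le_r
  have := H.three_mul_d_le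
  have := H.d_pos
  obtain ⟨s', rfl⟩ := H.exists_eq_succ
  have even_s' : Even s' := by
    have odd_s : Odd (s' + 1) := by
      rw [H.s_eq]
      exact H.odd_p.pow.mul (H.odd_c.add_even even_two)
    grind
  constructor
  · rw [skewDefect_pattern_first p H.q_eq H.r_eq (by omega) H.d_eq (by omega) hj₁ hjr hb ha,
      even_s'.neg_one_pow, sub_self]
  · exact skewDefect_pattern_first_shifted p H.q_eq H.r_eq (by omega) H.d_eq (by omega) hj₁ hb
      (by omega)

omit hbefore in
theorem exists_skewDefect_pattern_eq_zero {v j : ℕ} (hv : v < p ^ l) (hj₁ : 2 ≤ j)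
    (hjr : j < r) (hi : i + 2 * d = q * r * (s + 1) + q * r * v + q * j + q) :
    ∃ a b, i = a + b + 1 ∧ d * p ∣ a + d + 1 ∧ d * p ∣ b + d ∧
      skewDefect (pattern (R := R) q r d s) a b = 0 ∧
      skewDefect (pattern (R := R) q r d s) (a + d) b = 0 := by
  have := H.three_mul_d_le
  have := H.d_pos
  have := H.three_mul_q_le
  have := H.q_mul_r_le_Q
  have : q * 2 ≤ q * j := Nat.mul_le_mul_left q hj₁
  have dvd_q := H.d_mul_p_dvd_q
  have dvd_qr : d * p ∣ q * r := dvd_q.mul_right r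
  obtain rfl | hv₀ := Nat.eq_zero_or_pos v
  · have succ_period : q * r * (s + 1) = q * r * s + q * r := mul_add_one _ _
    obtain ⟨a, ha⟩ : ∃ a, a + 1 + d = q * r + q := ⟨q * r + q - 1 - d, by omega⟩
    obtain ⟨b, hb⟩ : ∃ b, b + d = q * r * s + q * j := ⟨q * r * s + q * j - d, by omega⟩
    refine ⟨a, b, by omega, ?_, ?_, H.skewDefect_pattern_of_mid_first (by omega) hjr ha hb⟩
    · rw [add_right_comm, ha]
      exact dvd_add dvd_qr dvd_q
    · rw [hb]
      exact dvd_add (dvd_qr.mul_right s) (dvd_q.mul_right j)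
  · have : Q * (c + 2) = Q * (c + 1) + Q := mul_add_one _ _
    have succ_period : q * r * (s + 1) = Q * (c + 2) + q * r := by
      rw [mul_add_one, H.q_mul_r_mul_s_eq]
    have : q * r * 1 ≤ q * r * v := Nat.mul_le_mul_left _ hv₀
    have : q * (j + 1) ≤ q * r := Nat.mul_le_mul_left q hjr
    have : q * (j + 1) = q * j + q := mul_add_one _ _
    have := H.mul_add_period_le hv
    obtain ⟨a, ha⟩ : ∃ a, a + 1 + d = Q * (c + 1) + (q * r * v + q * j + q) :=
      ⟨Q * (c + 1) + (q * r * v + q * j + q) - 1 - d, by omega⟩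
    obtain ⟨b, hb⟩ : ∃ b, b + d = q * r + Q := ⟨q * r + Q - d, by omega⟩
    refine ⟨a, b, by omega, ?_, hb ▸ H.d_mul_p_dvd_q_mul_r_add_Q,
      H.skewDefect_pattern_eq_zero hb ha (by omega) (by omega),
      H.skewDefect_pattern_eq_zero (M := q * r * v + q * j + q + d) hb (by omega) (by omega)
        (by omega)⟩
    rw [add_right_comm, ha]
    exact dvd_add (H.d_mul_p_dvd_Q.mul_right _)
      (dvd_add (dvd_add (dvd_qr.mul_right v) (dvd_q.mul_right j)) dvd_q)

theorem eq_pattern_of_mid {v j N : ℕ} (hv : v < p ^ l) (hj₁ : 2 ≤ j) (hjr : j < r)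
    (hN : N + 2 * d = q * r * (s + 1) + q * r * v + q * j) (hi : i = N + q) :
    ε i = pattern q r d s i := by
  have := H.three_mul_d_le
  have := H.d_pos
  have tooth : q * (r * (s + 1 + v) + j) = q * r * (s + 1) + q * r * v + q * j := by ring
  have succ_tooth : q * (r * (s + 1 + v) + j + 1) = q * (r * (s + 1 + v) + j) + q := by ring
  have hA : r * (s + 1) + 2 ≤ r * (s + 1 + v) + j :=
    add_le_add (Nat.mul_le_mul_left r (Nat.le_add_right _ _)) hj₁
  have hmod : (r * (s + 1 + v) + j) % r ≠ 1 := by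
    rw [Nat.mul_add_mod, Nat.mod_eq_of_lt hjr]
    omega
  have hafter : Set.EqOn ε (pattern q r d s) (Set.Ioc i (i + d)) := by
    rintro x ⟨h₁, h₂⟩
    rw [H.eq_zero_after_of_tooth hbefore hA hmod (by omega) hi x h₁ h₂,
      H.pattern_near_tooth (A := r * (s + 1 + v) + j + 1) (by omega) (by omega) (by omega)
        (by omega)]
  obtain ⟨a, b, hab, ha, hb, h₁, h₂⟩ :=
    H.exists_skewDefect_pattern_eq_zero (i := i) hv hj₁ hjr (by omega)
  exact H.eq_pattern_of_skewDefect hbefore hafter hab ha hb h₁ h₂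

theorem eq_pattern_of_after_tooth {A N : ℕ} (hA : r * (s + 1) + 2 ≤ A) (hmod : A % r ≠ 1)
    (hN : N + 2 * d = q * A) (h₁ : N < i) (h₂ : i < N + q) : ε i = pattern q r d s i := by
  rw [H.eq_zero_after_tooth hbefore hA hmod hN h₁ h₂ le_rfl,
    H.pattern_near_tooth hA (by omega) (by omega) (by omega)]

theorem eq_pattern_of_tooth_end {v j N : ℕ} (hj : j < r) (hj₁ : j ≠ 1)
    (h₁ : r * (s + 1) + 2 ≤ r * (s + 1 + v) + j)
    (hN : N + 2 * d = q * r * (s + 1) + q * r * v + q * j) (h₂ : N < i) (h₃ : i ≤ N + q)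
    (hi : j = 0 → i ≠ N + q) (hv : 2 ≤ j → v < p ^ l) : ε i = pattern q r d s i := by
  have tooth : q * (r * (s + 1 + v) + j) = q * r * (s + 1) + q * r * v + q * j := by ring
  have hmod : (r * (s + 1 + v) + j) % r ≠ 1 := by
    rwa [Nat.mul_add_mod, Nat.mod_eq_of_lt hj]
  obtain rfl | hlt := h₃.eq_or_lt
  · have hj₂ : 2 ≤ j := by grind
    exact H.eq_pattern_of_mid hbefore (hv hj₂) hj₂ hj hN rfl
  · exact H.eq_pattern_of_after_tooth hbefore h₁ hmod (hN.trans tooth.symm) h₂ hlt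

theorem eq_pattern_of_before (h₁ : q * r * (s + 1) + 2 * q < i + 2 * d)
    (h₂ : i + 2 * d ≤ q * r * (s + 1) + Q + 2 * q) : ε i = pattern q r d s i := by
  have := H.three_le_r
  have := H.three_mul_d_le
  have := H.d_pos
  have := H.three_mul_q_le
  have : q * r ≤ q * r * (s + 1) := Nat.le_mul_of_pos_right _ s.succ_pos
  obtain ⟨v, j, f, hj, hf, hi⟩ : ∃ v j f, j < r ∧ f < q ∧
      i + 2 * d = q * r * (s + 1) + q * r * v + q * j + f + 1 := by
    obtain ⟨v, j, f, hj, hf, h⟩ :=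
      exists_eq_mul_add_mul_add (by omega : 0 < q) (by omega : 0 < r)
        (i + 2 * d - 1 - q * r * (s + 1))
    exact ⟨v, j, f, hj, hf, by omega⟩
  obtain ⟨N, hN⟩ : ∃ N, N + 2 * d = q * r * (s + 1) + q * r * v :=
    ⟨q * r * (s + 1) + q * r * v - 2 * d, by omega⟩
  have hv₀ : v = 0 ∨ 1 ≤ v := v.eq_zero_or_pos
  by_cases hgap : N + q ≤ i ∧ i ≤ N + 2 * q
  · have hv₁ : 1 ≤ v := hv₀.resolve_left (by rintro rfl; omega)
    exact H.eq_pattern_in_gap hbefore hv₁ (H.le_of_lt_period (by omega)) hN hgap.1 hgap.2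
  · have hj₁ : j ≠ 1 := by rintro rfl; omega
    have hj₂ : 2 ≤ j → q * 2 ≤ q * j := Nat.mul_le_mul_left q
    have start : r * (s + 1 + v) = r * (s + 1) + r * v := mul_add _ _ _
    have hA : r * (s + 1) + 2 ≤ r * (s + 1 + v) + j := by
      obtain rfl | hv₁ := hv₀
      · have : j ≠ 0 := by rintro rfl; omega
        omega
      · have : r * 1 ≤ r * v := Nat.mul_le_mul_left r hv₁
        omega
    refine H.eq_pattern_of_tooth_end hbefore hj hj₁ hA (N := N + q * j) (by omega) (by omega)
      (by omega) (by rintro rfl; omega) fun hj₂' => ?_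
    have := hj₂ hj₂'
    refine lt_of_mul_lt_mul_left (a := q * r) ?_ (Nat.zero_le _)
    rw [← H.Q_eq]
    omega

end Continuation

theorem eqOn_pattern :
    Set.EqOn ε (pattern q r d s) {x | 1 ≤ x ∧ x + 2 * d ≤ q * r * (s + 1) + Q + 2 * q} := by
  rintro i ⟨hi₁, hi₂⟩
  induction i using Nat.strong_induction_on with
  | _ i ih =>
    by_cases h : i + 2 * d ≤ q * r * (s + 1) + 2 * q
    · exact H.eq_pattern i hi₁ h
    · exact H.eq_pattern_of_before (fun x hx => ih x hx.2 hx.1 (by have := hx.2; omega))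
        (by omega) hi₂

theorem false : False := by
  have := H.three_mul_d_le
  have := H.q_mul_r_le_Q
  have := H.three_mul_q_le
  have succ_period : q * r * (s + 1) = Q * (c + 2) + q * r := by
    rw [mul_add_one, H.q_mul_r_mul_s_eq]
  obtain ⟨b, hb⟩ : ∃ b, b + d = q * r + Q := ⟨q * r + Q - d, by omega⟩
  obtain ⟨a, ha⟩ : ∃ a, a + 1 + d = Q * (c + 2) + 2 * q :=
    ⟨Q * (c + 2) + 2 * q - 1 - d, by have := H.d_pos; omega⟩
  have defect := H.skewDefect_pattern_eq_add_two (R := R) H.odd_c hb ha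
  rw [← skewDefect_congr fun x h₁ h₂ => H.eqOn_pattern ⟨h₁, by omega⟩,
    H.isAdmissible.skewDefect_eq_zero] at defect
  exact H.not_dvd ((CharP.cast_eq_zero_iff R p (c + 2)).1 (mod_cast defect.symm))

end StartsLikePattern

end Contradiction

theorem IsAdmissible.exists_eq_pow_of_eq_pattern {R : Type*} [CommRing R] [IsDomain R] {p : ℕ}
    [hp : Fact p.Prime] [CharP R p] {ε : ℕ → R} (hε : IsAdmissible ε) {h k β s : ℕ}
    (hp₂ : p ≠ 2) (hk : 1 ≤ k) (hβ : β < h) (hs : 1 ≤ s)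
    (heq : ∀ x, 1 ≤ x → x + 2 * p ^ β ≤ p ^ h * p ^ k * (s + 1) + 2 * p ^ h →
      ε x = pattern (p ^ h) (p ^ k) (p ^ β) s x) :
    ∃ l, s = p ^ l := by
  obtain ⟨l, u, hu, rfl⟩ := Nat.exists_eq_pow_mul_and_not_dvd (by omega : s ≠ 0) p hp.out.ne_one
  refine ⟨l, ?_⟩
  obtain rfl | rfl | ⟨c, rfl⟩ : u = 0 ∨ u = 1 ∨ ∃ c, u = c + 2 := by
    obtain _ | _ | c := u
    exacts [.inl rfl, .inr (.inl rfl), .inr (.inr ⟨c, rfl⟩)]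
  · exact absurd (dvd_zero p) hu
  · exact mul_one _
  · exact (StartsLikePattern.false (ε := ε) (R := R) (p := p) (Q := p ^ h * p ^ k * p ^ l)
      { ne_two := hp₂, q_eq := rfl, r_eq := rfl, d_eq := rfl, s_eq := rfl, Q_eq := rfl, k_pos := hk,
        β_lt := hβ, not_dvd := hu, isAdmissible := hε, eq_pattern := heq }).elim

section Positions

/-- Starting from `i`, the consecutive positions at which `g` holds have the given differences. -/
def HasGapsFrom (g : ℕ → Prop) : ℕ → List ℕ → Prop
  | _, [] => True
  | i, m :: ms => (1 ≤ m ∧ g (i + m) ∧ ∀ j, i < j → j < i + m → ¬g j) ∧ HasGapsFrom g (i + m) ms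

variable {g g' : ℕ → Prop} {i : ℕ} {l l' : List ℕ}

theorem hasGapsFrom_append :
    HasGapsFrom g i (l ++ l') ↔ HasGapsFrom g i l ∧ HasGapsFrom g (i + l.sum) l' := by
  induction l generalizing i with
  | nil => simp [HasGapsFrom]
  | cons m ms ih => simp only [List.cons_append, HasGapsFrom, ih, List.sum_cons, and_assoc,
      add_assoc]

theorem hasGapsFrom_singleton {m : ℕ} :
    HasGapsFrom g i [m] ↔ 1 ≤ m ∧ g (i + m) ∧ ∀ j, i < j → j < i + m → ¬g j :=
  and_iff_left trivial

theorem hasGapsFrom_flatten_replicate {n : ℕ}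
    (h : ∀ t, t < n → HasGapsFrom g (i + l.sum * t) l) :
    HasGapsFrom g i (List.replicate n l).flatten := by
  induction n generalizing i with
  | zero => trivial
  | succ n ih =>
    rw [List.replicate_succ, List.flatten_cons, hasGapsFrom_append]
    refine ⟨by simpa using h 0 n.succ_pos, ih fun t ht => ?_⟩
    have := h (t + 1) (by omega)
    rwa [mul_add_one, add_comm (l.sum * t), ← add_assoc] at this

theorem hasGapsFrom_replicate {m n : ℕ} (h : ∀ t, t < n → HasGapsFrom g (i + m * t) [m]) :
    HasGapsFrom g i (List.replicate n m) := by
  have := hasGapsFrom_flatten_replicate (l := [m]) (i := i) (n := n) (g := g) (by simpa using h)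
  simpa using this

theorem HasGapsFrom.of_shift {e : ℕ} (h : HasGapsFrom g (i + e) l)
    (hg : ∀ x, i < x → x ≤ i + l.sum → (g' x ↔ g (x + e))) : HasGapsFrom g' i l := by
  induction l generalizing i with
  | nil => trivial
  | cons m ms ih =>
    obtain ⟨⟨hm, at_end, before⟩, tail⟩ := h
    rw [List.sum_cons] at hg
    refine ⟨⟨hm, ?_, fun j hj₁ hj₂ => ?_⟩,
      ih (by rwa [add_right_comm]) fun x hx₁ hx₂ => hg x (by omega) (by omega)⟩
    · rwa [hg _ (by omega) (by omega), add_right_comm]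
    · rw [hg _ hj₁ (by omega)]
      exact before _ (by omega) (by omega)

theorem HasGapsFrom.iff (h : HasGapsFrom g i l) (h' : HasGapsFrom g' i l) {x : ℕ} (hx₁ : i < x)
    (hx₂ : x ≤ i + l.sum) : g x ↔ g' x := by
  induction l generalizing i with
  | nil => exact absurd hx₂ (by simpa using hx₁)
  | cons m ms ih =>
    obtain ⟨⟨-, at_end, before⟩, tail⟩ := h
    obtain ⟨⟨-, at_end', before'⟩, tail'⟩ := h'
    rw [List.sum_cons, ← add_assoc] at hx₂
    rcases lt_trichotomy x (i + m) with hlt | rfl | hgt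
    · exact iff_of_false (before x hx₁ hlt) (before' x hx₁ hlt)
    · exact iff_of_true at_end at_end'
    · exact ih tail tail' hgt hx₂

theorem HasConstituentsFrom.hasGapsFrom {F L : Type*} [Field F] [LieRing L] [LieAlgebra F L]
    {A : ℕ → Submodule F L} (h : HasConstituentsFrom A i l) :
    HasGapsFrom (fun x => twoStepCentralizer A x ≠ twoStepCentralizer A 2) i l := by
  induction l generalizing i with
  | nil => trivial
  | cons m ms ih =>
    obtain ⟨⟨-, hm, -, at_end, before⟩, tail⟩ := h
    exact ⟨⟨hm, at_end, fun j hj₁ hj₂ => not_not.2 (before j hj₁ hj₂)⟩, ih tail⟩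

variable {R : Type*} [Zero R] [One R] {q r d s : ℕ}

theorem pattern_eq_one_of_ne_zero {x : ℕ} (h : pattern (R := R) q r d s x ≠ 0) :
    pattern (R := R) q r d s x = 1 := by
  rw [pattern, comb] at h ⊢
  exact if_pos (by_contra fun h' => h (if_neg h'))

variable [NeZero (1 : R)]

theorem hasGapsFrom_comb_gap {b e : ℕ} (hr : 2 ≤ r) (he : e < 2 * q) :
    HasGapsFrom (comb (R := R) q r · ≠ 0) (q * r * b + e) [2 * q - e] := by
  refine hasGapsFrom_singleton.2 ⟨by omega, ?_, fun j hj₁ hj₂ => not_not.2 ?_⟩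
  · have tooth := comb_add_mul_of_two_le (R := R) (q := q) (b := b) (by omega) le_rfl hr
    rw [show q * r * b + e + (2 * q - e) = q * r * b + q * 2 by omega, tooth]
    exact one_ne_zero
  · exact comb_of_gap hr (b := b) (by omega) (by omega)

theorem hasGapsFrom_comb_teeth (hq : 0 < q) (b : ℕ) :
    HasGapsFrom (comb (R := R) q r · ≠ 0) (q * r * b + 2 * q) (List.replicate (r - 2) q) := by
  refine hasGapsFrom_replicate fun t ht => hasGapsFrom_singleton.2 ⟨hq, ?_, fun j hj₁ hj₂ => ?_⟩
  · rw [show q * r * b + 2 * q + q * t + q = q * r * b + q * (t + 3) by ring,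
      comb_add_mul_of_two_le hq (by omega) (by omega)]
    exact one_ne_zero
  · have tooth : q * (r * b + t + 2) = q * r * b + 2 * q + q * t := by ring
    exact not_not.2 (comb_of_between (a := r * b + t + 2) (by omega) (by omega))

theorem sum_replicate_teeth (hr : 2 ≤ r) :
    (List.replicate (r - 2) q).sum + 2 * q = q * r := by
  obtain ⟨m, rfl⟩ := Nat.exists_eq_add_of_le' hr
  rw [List.sum_replicate, smul_eq_mul, Nat.add_sub_cancel]
  ring

theorem sum_flatten_replicate_period (hr : 2 ≤ r) (n : ℕ) :
    (List.replicate n (List.replicate (r - 2) q ++ [2 * q])).flatten.sum = q * r * n := by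
  rw [List.sum_flatten, List.map_replicate, List.sum_replicate, List.sum_append,
    List.sum_singleton, sum_replicate_teeth hr, smul_eq_mul, mul_comm]

theorem hasGapsFrom_comb_periods (hq : 0 < q) (hr : 2 ≤ r) (n b : ℕ) :
    HasGapsFrom (comb (R := R) q r · ≠ 0) (q * r * b + 2 * q)
      ((List.replicate n (List.replicate (r - 2) q ++ [2 * q])).flatten ++
        List.replicate (r - 2) q) := by
  rw [hasGapsFrom_append, sum_flatten_replicate_period hr]
  constructor
  · refine hasGapsFrom_flatten_replicate fun t _ => hasGapsFrom_append.2 ?_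
    rw [List.sum_append, List.sum_singleton, sum_replicate_teeth hr]
    have start : q * r * b + 2 * q + q * r * t = q * r * (b + t) + 2 * q := by ring
    have gap : q * r * (b + t) + 2 * q + (List.replicate (r - 2) q).sum =
        q * r * (b + t + 1) + 0 := by
      rw [add_assoc, add_comm (2 * q), sum_replicate_teeth hr]
      ring
    rw [start, gap]
    exact ⟨hasGapsFrom_comb_teeth hq (b + t), hasGapsFrom_comb_gap hr (by omega)⟩
  · rw [add_right_comm, ← mul_add]
    exact hasGapsFrom_comb_teeth hq (b + n)

theorem hasGapsFrom_pattern_first (hr : 2 ≤ r) (hq : 0 < q) :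
    HasGapsFrom (pattern (R := R) q r d s · ≠ 0) (2 * q) (List.replicate (r - 2) q) := by
  have teeth := hasGapsFrom_comb_teeth (R := R) (r := r) hq 0
  rw [mul_zero, zero_add] at teeth
  have := sum_replicate_teeth (q := q) hr
  exact teeth.of_shift (e := 0) fun x _ hx => by rw [pattern_of_le (by omega), add_zero]

theorem hasGapsFrom_pattern_first_shift (hr : 2 ≤ r) (hd : d < 2 * q) (hs : 1 ≤ s) :
    HasGapsFrom (pattern (R := R) q r d s · ≠ 0) (q * r) [2 * q - d] := by
  have gap := hasGapsFrom_comb_gap (R := R) (b := 1) hr hd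
  rw [mul_one] at gap
  have : q * 2 ≤ q * r := Nat.mul_le_mul_left q hr
  have : q * r * 2 ≤ q * r * (s + 1) := Nat.mul_le_mul_left _ (by omega)
  exact gap.of_shift fun x hx₁ hx₂ => by
    rw [List.sum_singleton] at hx₂
    rw [pattern_of_mid hx₁ (by omega)]

theorem hasGapsFrom_pattern_mid (hr : 2 ≤ r) (hd : d < 2 * q) (hs : 1 ≤ s) :
    HasGapsFrom (pattern (R := R) q r d s · ≠ 0) (q * r + (2 * q - d))
      ((List.replicate (s - 1) (List.replicate (r - 2) q ++ [2 * q])).flatten ++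
        List.replicate (r - 2) q) := by
  have periods := hasGapsFrom_comb_periods (R := R) (by omega : 0 < q) hr (s - 1) 1
  rw [mul_one, show q * r + 2 * q = q * r + (2 * q - d) + d by omega] at periods
  refine periods.of_shift fun x hx₁ hx₂ => ?_
  have := sum_replicate_teeth (q := q) hr
  obtain ⟨s, rfl⟩ := Nat.exists_eq_add_of_le' hs
  have succ_period : q * r * (s + 1 + 1) = q * r * s + q * r + q * r := by ring
  rw [List.sum_append, sum_flatten_replicate_period hr, Nat.add_sub_cancel] at hx₂
  rw [pattern_of_mid (by omega) (by omega)]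

theorem hasGapsFrom_pattern_second_shift (hr : 2 ≤ r) (hd : d < q) (hs : 1 ≤ s) {N : ℕ}
    (hN : N + d = q * r * (s + 1)) :
    HasGapsFrom (pattern (R := R) q r d s · ≠ 0) N [2 * q - d] := by
  have : q * 2 ≤ q * r := Nat.mul_le_mul_left q hr
  have : q * r * 2 ≤ q * r * (s + 1) := Nat.mul_le_mul_left _ (by omega)
  have gap := hasGapsFrom_comb_gap (R := R) (b := s + 1) (e := d) hr (by omega : d < 2 * q)
  rw [← hN, add_assoc, ← two_mul] at gap
  refine gap.of_shift fun x hx₁ _ => ?_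
  rcases le_or_gt x (q * r * (s + 1)) with hle | hgt
  · rw [pattern_of_mid (by omega) hle, comb_of_gap (b := s + 1) hr (by omega) (by omega),
      comb_of_gap (b := s + 1) hr (by omega) (by omega)]
  · rw [pattern_of_gt hgt]

theorem hasGapsFrom_pattern (hr : 2 ≤ r) (hd : d < q) (hs : 1 ≤ s) :
    HasGapsFrom (pattern (R := R) q r d s · ≠ 0) (2 * q) (initialPattern q r d s).tail := by
  have tail_eq : (initialPattern q r d s).tail = List.replicate (r - 2) q ++ ([2 * q - d] ++
      (((List.replicate (s - 1) (List.replicate (r - 2) q ++ [2 * q])).flatten ++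
        List.replicate (r - 2) q) ++ [2 * q - d])) := by
    simp [initialPattern]
  have teeth := sum_replicate_teeth (q := q) hr
  obtain ⟨s, rfl⟩ := Nat.exists_eq_add_of_le' hs
  have succ_period : q * r * (s + 1 + 1) = q * r * s + q * r + q * r := by ring
  rw [tail_eq, hasGapsFrom_append, hasGapsFrom_append, hasGapsFrom_append, List.sum_singleton,
    List.sum_append, sum_flatten_replicate_period hr, Nat.add_sub_cancel, add_comm (2 * q), teeth]
  exact ⟨hasGapsFrom_pattern_first hr (by omega), hasGapsFrom_pattern_first_shift hr (by omega) hs,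
    hasGapsFrom_pattern_mid hr (by omega) hs, hasGapsFrom_pattern_second_shift hr hd hs (by omega)⟩

omit [NeZero (1 : R)] in
theorem sum_initialPattern (hr : 2 ≤ r) (hd : d ≤ 2 * q) (hs : 1 ≤ s) :
    (initialPattern q r d s).sum + 2 * d = q * r * (s + 1) + 2 * q := by
  obtain ⟨s, rfl⟩ := Nat.exists_eq_add_of_le' hs
  have succ_period : q * r * (s + 1 + 1) = q * r * s + q * r + q * r := by ring
  have teeth := sum_replicate_teeth (q := q) hr
  simp only [initialPattern, List.sum_append, List.sum_singleton, Nat.add_sub_cancel,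
    sum_flatten_replicate_period hr]
  omega

variable {F L : Type*} [Field F] [LieRing L] [LieAlgebra F L] {A : ℕ → Submodule F L}

theorem ConstituentLengthsBeginWith.ne_iff_pattern_ne_zero (hr : 2 ≤ r) (hd : d < q)
    (hs : 1 ≤ s) (h : ConstituentLengthsBeginWith A (initialPattern q r d s)) {x : ℕ}
    (hx : 2 ≤ x) (hx' : x + 2 * d ≤ q * r * (s + 1) + 2 * q) :
    twoStepCentralizer A x ≠ twoStepCentralizer A 2 ↔ pattern (R := R) q r d s x ≠ 0 := by
  have list_eq : initialPattern q r d s = 2 * q :: (initialPattern q r d s).tail := rfl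
  have sum_eq := sum_initialPattern (q := q) (d := d) (s := s) hr (by omega) hs
  have : q * 2 ≤ q * r := Nat.mul_le_mul_left q hr
  rw [list_eq, List.sum_cons] at sum_eq
  rw [list_eq] at h
  obtain ⟨⟨-, at_end, before⟩, tail⟩ := h
  have gap := hasGapsFrom_comb_gap (R := R) (b := 0) (e := 0) hr (by omega : 0 < 2 * q)
  obtain ⟨-, at_end', before'⟩ := hasGapsFrom_singleton.1 gap
  rcases lt_or_ge (2 * q) x with hgt | hle
  · exact tail.hasGapsFrom.iff (hasGapsFrom_pattern hr hd hs) hgt (by omega)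
  · rw [pattern_of_le (by omega)]
    obtain rfl | hlt := hle.eq_or_lt
    · exact iff_of_true at_end (by simpa using at_end')
    · exact iff_of_false (not_not.2 (before x hx hlt)) (before' x (by omega) (by omega))

end Positions

section StructureConstants

section Lie

theorem lie_lie_right {M : Type*} [LieRing M] (u a b : M) :
    ⁅u, ⁅a, b⁆⁆ = ⁅⁅u, a⁆, b⁆ - ⁅⁅u, b⁆, a⁆ := by
  rw [leibniz_lie, ← lie_skew a ⁅u, b⁆, sub_eq_add_neg]

variable {R M : Type*} [CommRing R] [LieRing M] [LieAlgebra R M] {e : ℕ → M} {z : M} {ε : ℕ → R}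

theorem lie_eq_iterDiff_smul (hz : ∀ i, 1 ≤ i → ⁅e i, z⁆ = e (i + 1))
    (hy : ∀ i, 1 ≤ i → ⁅e i, e 1⁆ = ε i • e (i + 1)) (k : ℕ) {m : ℕ} (hm : 1 ≤ m) :
    ⁅e m, e (k + 1)⁆ = iterDiff ε m k • e (m + k + 1) := by
  induction k generalizing m with
  | zero => exact hy m hm
  | succ k ih =>
    rw [← hz (k + 1) (by omega), lie_lie_right, ih hm, hz m hm, ih (by omega), smul_lie,
      hz _ (by omega), iterDiff_succ, sub_smul, show m + 1 + k + 1 = m + k + 1 + 1 by omega]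
    rfl

theorem isAdmissible_of_lie [IsCancelMulZero R] [Module.IsTorsionFree R M]
    (hne : ∀ i, 1 ≤ i → e i ≠ 0) (hz : ∀ i, 1 ≤ i → ⁅e i, z⁆ = e (i + 1))
    (hy : ∀ i, 1 ≤ i → ⁅e i, e 1⁆ = ε i • e (i + 1)) : IsAdmissible ε := by
  have lie_eq (k : ℕ) {m : ℕ} (hm : 1 ≤ m) := lie_eq_iterDiff_smul hz hy k hm
  refine ⟨fun a b => ?_, fun m k => ?_⟩
  · have skew := lie_skew (e (a + 1)) (e (b + 1))
    rw [lie_eq a (by omega), lie_eq b (by omega),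
      show b + 1 + a + 1 = a + 1 + b + 1 by omega, ← neg_smul] at skew
    exact (smul_left_injective R (hne _ (by omega)) skew).symm
  · have jacobi := lie_lie_right (e (m + 1)) (e (k + 1)) (e 1)
    have degree₁ : m + 1 + (k + 1) + 1 = m + k + 3 := by omega
    have degree₂ : m + 1 + k + 1 = m + k + 2 := by omega
    have degree₃ : m + 1 + 1 + k + 1 = m + k + 3 := by omega
    rw [hy (k + 1) (by omega), hy (m + 1) (by omega), lie_smul, smul_lie,
      lie_eq (k + 1) (by omega), lie_eq k (by omega), lie_eq k (by omega), smul_lie, degree₁,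
      degree₂, degree₃, hy _ (by omega), smul_smul, smul_smul, smul_smul, ← sub_smul] at jacobi
    have coeff_eq := smul_left_injective R (hne _ (by omega)) jacobi
    linear_combination -coeff_eq

theorem isAdmissible_div {K M : Type*} [Field K] [LieRing M] [LieAlgebra K M] {v : ℕ → M} {z : M}
    {a b : ℕ → K} {t : K} (ht : t ≠ 0) (hv : ∀ i, 1 ≤ i → v i ≠ 0) (ha : ∀ i, 1 ≤ i → a i ≠ 0)
    (hz : ∀ i, 1 ≤ i → ⁅v i, z⁆ = a i • v (i + 1))
    (hy : ∀ i, 1 ≤ i → ⁅v i, v 1⁆ = b i • v (i + 1)) :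
    IsAdmissible fun i => t * b i / a i := by
  let c (i : ℕ) : K := t * ∏ j ∈ Finset.Ico 1 i, a j
  have c_ne_zero (i : ℕ) : c i ≠ 0 :=
    mul_ne_zero ht (Finset.prod_ne_zero_iff.2 fun j hj => ha j (Finset.mem_Ico.1 hj).1)
  have c_succ {i : ℕ} (hi : 1 ≤ i) : c (i + 1) = c i * a i := by
    rw [mul_assoc, ← Finset.prod_Ico_succ_top hi]
  have c_one : c 1 = t := by rw [← mul_one t]; rfl
  refine isAdmissible_of_lie (e := fun i => c i • v i) (z := z)
    (fun i hi => smul_ne_zero (c_ne_zero i) (hv i hi)) (fun i hi => ?_) (fun i hi => ?_)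
  · rw [smul_lie, hz i hi, smul_smul, c_succ hi]
  · have := ha i hi
    rw [smul_lie, lie_smul, hy i hi, smul_smul, smul_smul, smul_smul, c_succ hi, c_one]
    congr 1
    field_simp

end Lie

section ExtendScalars

open scoped TensorProduct

theorem one_tmul_lie_one_tmul {R : Type*} (B : Type*) {L : Type*} [CommRing R] [CommRing B]
    [Algebra R B] [LieRing L] [LieAlgebra R L] {u w v : L} {c : R} (h : ⁅u, w⁆ = c • v) :
    ⁅(1 : B) ⊗ₜ[R] u, (1 : B) ⊗ₜ[R] w⁆ = algebraMap R B c • ((1 : B) ⊗ₜ[R] v) := by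
  rw [LieAlgebra.ExtendScalars.bracket_tmul, mul_one, h, TensorProduct.tmul_smul, algebraMap_smul]

variable {F : Type*} [Field F]

theorem algebraMap_add_X_mul_ne_zero {a b : F} (h : a ≠ 0 ∨ b ≠ 0) :
    algebraMap F (RatFunc F) a + RatFunc.X * algebraMap F (RatFunc F) b ≠ 0 := by
  have linear_ne_zero : Polynomial.C a + Polynomial.X * Polynomial.C b ≠ 0 := by
    intro linear_eq
    have coeff_zero := congrArg (Polynomial.coeff · 0) linear_eq
    have coeff_one := congrArg (Polynomial.coeff · 1) linear_eq
    simp only [Polynomial.coeff_add, Polynomial.coeff_X_mul, Polynomial.coeff_C_zero,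
      Polynomial.coeff_X_mul_zero, Polynomial.coeff_C_succ, Polynomial.coeff_zero, add_zero,
      zero_add] at coeff_zero coeff_one
    exact h.elim (· coeff_zero) (· coeff_one)
  have := (map_ne_zero_iff _ (RatFunc.algebraMap_injective F)).2 linear_ne_zero
  rwa [map_add, map_mul, RatFunc.algebraMap_X, RatFunc.algebraMap_C, RatFunc.algebraMap_C] at this

variable {L : Type*} [LieRing L] [LieAlgebra F L]

theorem exists_isAdmissible {x : L} {v : ℕ → L} {α ε : ℕ → F} (hv : ∀ i, 1 ≤ i → v i ≠ 0)
    (hx : ∀ i, 1 ≤ i → ⁅v i, x⁆ = α i • v (i + 1))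
    (hy : ∀ i, 1 ≤ i → ⁅v i, v 1⁆ = ε i • v (i + 1))
    (hne : ∀ i, 1 ≤ i → α i ≠ 0 ∨ ε i ≠ 0) :
    ∃ δ : ℕ → RatFunc F, IsAdmissible δ ∧ (∀ i, ε i = 0 → δ i = 0) ∧
      ∀ i, 1 ≤ i → α i = 0 → δ i = 1 := by
  have a_ne_zero (i : ℕ) (hi : 1 ≤ i) := algebraMap_add_X_mul_ne_zero (hne i hi)
  refine ⟨_, isAdmissible_div (M := RatFunc F ⊗[F] L) (v := fun i => 1 ⊗ₜ v i)
    (z := 1 ⊗ₜ x + (RatFunc.X : RatFunc F) • (1 ⊗ₜ v 1)) RatFunc.X_ne_zero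
    (fun i hi h => hv i hi ?_) a_ne_zero (fun i hi => ?_)
    fun i hi => one_tmul_lie_one_tmul _ (hy i hi), fun i hi => ?_, fun i hi h => ?_⟩
  · exact Module.FaithfullyFlat.tensorProduct_mk_injective (A := F) (B := RatFunc F) L
      (h.trans (map_zero _).symm)
  · rw [lie_add, lie_smul, one_tmul_lie_one_tmul _ (hx i hi), one_tmul_lie_one_tmul _ (hy i hi),
      smul_smul, add_smul]
  · rw [hi, map_zero, mul_zero, zero_div]
  · have := a_ne_zero i hi
    rw [h, map_zero, zero_add] at this ⊢
    exact div_self this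

end ExtendScalars

theorem eq_top_of_lieSpan_eq_top {R L : Type*} [CommRing R] [LieRing L] [LieAlgebra R L]
    {S : Set L} {B : Submodule R L} (hS : LieSubalgebra.lieSpan R L S = ⊤) (hSB : S ⊆ B)
    (hlie : ∀ w ∈ S, ∀ b ∈ B, ⁅w, b⁆ ∈ B) : B = ⊤ := by
  have mem_lieSpan (w : L) : w ∈ LieSubalgebra.lieSpan R L S := hS ▸ LieSubalgebra.mem_top w
  have lie_mem (w : L) : ∀ b ∈ B, ⁅w, b⁆ ∈ B := by
    induction mem_lieSpan w using LieSubalgebra.lieSpan_induction with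
    | mem w hw => exact hlie w hw
    | zero => exact fun b _ => by rw [zero_lie]; exact B.zero_mem
    | add w w' _ _ h h' => exact fun b hb => add_lie w w' b ▸ B.add_mem (h b hb) (h' b hb)
    | smul c w _ h => exact fun b hb => smul_lie c w b ▸ B.smul_mem c (h b hb)
    | lie w w' _ _ h h' =>
      exact fun b hb => lie_lie w w' b ▸ B.sub_mem (h _ (h' b hb)) (h' _ (h b hb))
  refine Submodule.eq_top_iff'.2 fun w => ?_
  induction mem_lieSpan w using LieSubalgebra.lieSpan_induction with
  | mem w hw => exact hSB hw
  | zero => exact B.zero_mem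
  | add _ _ _ _ h h' => exact B.add_mem h h'
  | smul c _ _ h => exact B.smul_mem c h
  | lie w w' _ _ _ h' => exact lie_mem w w' h'

variable {F L : Type*} [Field F] [LieRing L] [LieAlgebra F L] {A : ℕ → Submodule F L}

theorem twoStepCentralizer_le (i : ℕ) : twoStepCentralizer A i ≤ A 1 := fun _ h => h.1

theorem IsFirstConstituent.unique {m n : ℕ} (hm : IsFirstConstituent A m)
    (hn : IsFirstConstituent A n) : m = n :=
  le_antisymm (not_lt.1 fun hlt => hn.2.1 (hm.2.2 n hn.1 hlt))
    (not_lt.1 fun hlt => hm.2.1 (hn.2.2 m hm.1 hlt))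

variable [GradedLieAlgebra A]

namespace IsMaximalClass

variable (hA : IsMaximalClass A)
include hA

theorem finite (i : ℕ) : FiniteDimensional F (A i) := by
  match i with
  | 0 => rw [hA.zero_eq_bot]; infer_instance
  | 1 => exact Module.finite_of_rank_eq_nat (n := 2) (by exact_mod_cast hA.rank_one)
  | i + 2 =>
    exact Module.rank_lt_aleph0_iff.1
      ((hA.rank_le_one _ (by omega)).trans_lt Cardinal.one_lt_aleph0)

theorem finrank_one : Module.finrank F (A 1) = 2 :=
  Module.finrank_eq_of_rank_eq (by exact_mod_cast hA.rank_one)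

theorem exists_eq_smul {i : ℕ} (hi : 2 ≤ i) {u w : L} (hu : u ∈ A i) (hu₀ : u ≠ 0)
    (hw : w ∈ A i) : ∃ c : F, w = c • u := by
  obtain ⟨t, -, ht⟩ := (rank_submodule_le_one_iff (A i)).1 (hA.rank_le_one i hi)
  obtain ⟨a, rfl⟩ := Submodule.mem_span_singleton.1 (ht hu)
  obtain ⟨b, rfl⟩ := Submodule.mem_span_singleton.1 (ht hw)
  have ha : a ≠ 0 := fun h => hu₀ (by rw [h, zero_smul])
  exact ⟨b / a, by rw [smul_smul, div_mul_cancel₀ _ ha]⟩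

theorem mem_twoStepCentralizer_iff {i : ℕ} (hi : 2 ≤ i) {u w : L} (hu : u ∈ A i) (hu₀ : u ≠ 0)
    (hw : w ∈ A 1) : w ∈ twoStepCentralizer A i ↔ ⁅u, w⁆ = 0 := by
  refine ⟨fun h => h.2 u hu, fun h => ⟨hw, fun t ht => ?_⟩⟩
  obtain ⟨c, rfl⟩ := hA.exists_eq_smul hi hu hu₀ ht
  rw [smul_lie, h, smul_zero]

variable (hinf : ¬FiniteDimensional F L)
include hinf

theorem exists_lie_ne_zero {i : ℕ} (hi : 1 ≤ i) : ∃ u ∈ A i, ∃ w ∈ A 1, ⁅u, w⁆ ≠ 0 := by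
  by_contra! lie_eq_zero
  have := hA.finite
  let B : Submodule F L := (Finset.Icc 1 i).sup A
  have le_B {j : ℕ} (h₁ : 1 ≤ j) (h₂ : j ≤ i) : A j ≤ B :=
    Finset.le_sup (f := A) (Finset.mem_Icc.2 ⟨h₁, h₂⟩)
  have lie_mem_B (w : L) (hw : w ∈ A 1) : B ≤ B.comap (LieAlgebra.ad F L w) := by
    refine Finset.sup_le fun j hj u hu => ?_
    rw [Finset.mem_Icc] at hj
    rw [Submodule.mem_comap, LieAlgebra.ad_apply]
    obtain hlt | rfl := hj.2.lt_or_eq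
    · exact le_B (by omega) (by omega) (SetLike.GradedBracket.bracket_mem hw hu)
    · rw [← lie_skew, lie_eq_zero u hu w hw, neg_zero]
      exact B.zero_mem
  have B_eq_top : B = ⊤ := eq_top_of_lieSpan_eq_top hA.generated (le_B le_rfl hi) lie_mem_B
  have finite_B : FiniteDimensional F B := Submodule.finiteDimensional_finset_sup _ A
  rw [B_eq_top] at finite_B
  exact hinf (Module.Finite.equiv (Submodule.topEquiv (R := F) (M := L)))

theorem exists_mem_ne_zero {i : ℕ} (hi : 1 ≤ i) : ∃ u ∈ A i, u ≠ 0 := by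
  obtain ⟨u, hu, w, -, h⟩ := hA.exists_lie_ne_zero hinf hi
  exact ⟨u, hu, fun hu₀ => h (by rw [hu₀, zero_lie])⟩

theorem exists_homogeneous_sequence {y : L} (hy : y ∈ A 1) (hy₀ : y ≠ 0) :
    ∃ v : ℕ → L, v 1 = y ∧ ∀ i, 1 ≤ i → v i ∈ A i ∧ v i ≠ 0 := by
  choose! t ht ht₀ using fun i (hi : 1 ≤ i) => hA.exists_mem_ne_zero hinf hi
  refine ⟨Function.update t 1 y, Function.update_self .., fun i hi => ?_⟩
  obtain rfl | hne := eq_or_ne i 1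
  · rw [Function.update_self]
    exact ⟨hy, hy₀⟩
  · rw [Function.update_of_ne hne]
    exact ⟨ht i hi, ht₀ i hi⟩

omit hinf in
theorem exists_forall_lie_eq_smul {v : ℕ → L} (hv : ∀ i, 1 ≤ i → v i ∈ A i ∧ v i ≠ 0) {w : L}
    (hw : w ∈ A 1) : ∃ c : ℕ → F, ∀ i, 1 ≤ i → ⁅v i, w⁆ = c i • v (i + 1) := by
  choose! c hc using fun i (hi : 1 ≤ i) => hA.exists_eq_smul (by omega) (hv _ (by omega)).1
    (hv (i + 1) (by omega)).2 (SetLike.GradedBracket.bracket_mem (hv i hi).1 hw)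
  exact ⟨c, hc⟩

theorem finrank_twoStepCentralizer_le {i : ℕ} (hi : 1 ≤ i) :
    Module.finrank F (twoStepCentralizer A i) ≤ 1 := by
  obtain ⟨u, hu, w, hw, h⟩ := hA.exists_lie_ne_zero hinf hi
  have := hA.finite 1
  have lt : twoStepCentralizer A i < A 1 :=
    SetLike.lt_iff_le_and_exists.2 ⟨twoStepCentralizer_le i, w, hw, fun h' => h (h'.2 u hu)⟩
  have finrank_lt := Submodule.finrank_lt_finrank_of_lt lt
  rw [hA.finrank_one] at finrank_lt
  omega

theorem exists_mem_twoStepCentralizer {i : ℕ} (hi : 2 ≤ i) :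
    ∃ w ∈ twoStepCentralizer A i, w ≠ 0 := by
  obtain ⟨u, hu, hu₀⟩ := hA.exists_mem_ne_zero hinf (by omega : 1 ≤ i)
  have := hA.finite
  let ad_u : A 1 →ₗ[F] A (i + 1) := (LieAlgebra.ad F L u).restrict fun w hw =>
    SetLike.GradedBracket.bracket_mem hu hw
  have ker_ne_bot : LinearMap.ker ad_u ≠ ⊥ := by
    refine LinearMap.ker_ne_bot_of_finrank_lt ?_
    rw [hA.finrank_one]
    exact Nat.lt_succ_of_le (Module.finrank_le_of_rank_le
      (by exact_mod_cast hA.rank_le_one (i + 1) (by omega)))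
  obtain ⟨w, hw, hw₀⟩ := (Submodule.ne_bot_iff _).1 ker_ne_bot
  refine ⟨w, (hA.mem_twoStepCentralizer_iff hi hu hu₀ w.2).2 ?_, fun h => hw₀ (Subtype.ext h)⟩
  exact congrArg Subtype.val (LinearMap.mem_ker.1 hw)

theorem twoStepCentralizer_eq_span {i : ℕ} (hi : 1 ≤ i) {w : L} (hw : w ∈ twoStepCentralizer A i)
    (hw₀ : w ≠ 0) : twoStepCentralizer A i = F ∙ w := by
  have := hA.finite 1
  have := Submodule.finiteDimensional_of_le (twoStepCentralizer_le (A := A) i)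
  have span_le : F ∙ w ≤ twoStepCentralizer A i := (Submodule.span_singleton_le_iff_mem _ _).2 hw
  refine (Submodule.eq_of_le_of_finrank_le span_le ?_).symm
  rw [finrank_span_singleton hw₀]
  exact hA.finrank_twoStepCentralizer_le hinf hi

theorem span_pair_eq {i j : ℕ} (hi : 1 ≤ i) (hj : 1 ≤ j)
    (hne : twoStepCentralizer A i ≠ twoStepCentralizer A j) {x y : L}
    (hx : x ∈ twoStepCentralizer A i) (hx₀ : x ≠ 0) (hy : y ∈ twoStepCentralizer A j)
    (hy₀ : y ≠ 0) : Submodule.span F {x, y} = A 1 := by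
  have := hA.finite 1
  have independent : LinearIndependent F ![x, y] := by
    refine (LinearIndependent.pair_iff' hx₀).2 fun c hc => hne ?_
    have hy' : y ∈ twoStepCentralizer A i := hc ▸ Submodule.smul_mem _ c hx
    rw [hA.twoStepCentralizer_eq_span hinf hi hy' hy₀,
      hA.twoStepCentralizer_eq_span hinf hj hy hy₀]
  refine Submodule.eq_of_le_of_finrank_eq (Submodule.span_le.2 (Set.pair_subset hx.1 hy.1)) ?_
  rw [hA.finrank_one, ← Matrix.range_cons_cons_empty x y ![], finrank_span_eq_card independent,
    Fintype.card_fin]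

theorem lie_ne_zero_of_span_pair_eq {x y : L} (hxy : Submodule.span F {x, y} = A 1) :
    ⁅y, x⁆ ≠ 0 := fun lie_eq_zero => by
  obtain ⟨u, hu, w, hw, h⟩ := hA.exists_lie_ne_zero hinf le_rfl
  rw [← hxy] at hu hw
  obtain ⟨a, b, rfl⟩ := Submodule.mem_span_pair.1 hu
  obtain ⟨a', b', rfl⟩ := Submodule.mem_span_pair.1 hw
  have lie_eq_zero' : ⁅x, y⁆ = 0 := by rw [← lie_skew, lie_eq_zero, neg_zero]
  exact h (by simp [lie_eq_zero, lie_eq_zero'])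

theorem lie_ne_zero_or_lie_ne_zero {x y : L} (hxy : Submodule.span F {x, y} = A 1) {i : ℕ}
    (hi : 2 ≤ i) {u : L} (hu : u ∈ A i) (hu₀ : u ≠ 0) : ⁅u, x⁆ ≠ 0 ∨ ⁅u, y⁆ ≠ 0 := by
  obtain ⟨_, hu', w, hw, h⟩ := hA.exists_lie_ne_zero hinf (by omega : 1 ≤ i)
  obtain ⟨c, rfl⟩ := hA.exists_eq_smul hi hu hu₀ hu'
  obtain ⟨a, b, rfl⟩ := Submodule.mem_span_pair.1 (hxy ▸ hw)
  by_contra! lie_eq_zero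
  exact h (by simp [lie_eq_zero.1, lie_eq_zero.2])

theorem exists_isAdmissible {n : ℕ} (hn : 2 ≤ n)
    (hne : twoStepCentralizer A n ≠ twoStepCentralizer A 2) :
    ∃ δ : ℕ → RatFunc F, IsAdmissible δ ∧ δ 1 = 0 ∧
      ∀ i, 2 ≤ i → (twoStepCentralizer A i = twoStepCentralizer A 2 → δ i = 0) ∧
        (twoStepCentralizer A i = twoStepCentralizer A n → δ i = 1) := by
  obtain ⟨x, hx, hx₀⟩ := hA.exists_mem_twoStepCentralizer hinf hn
  obtain ⟨y, hy, hy₀⟩ := hA.exists_mem_twoStepCentralizer hinf le_rfl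
  have hxy := hA.span_pair_eq hinf (by omega) (by omega) hne hx hx₀ hy hy₀
  obtain ⟨v, rfl, hv⟩ := hA.exists_homogeneous_sequence hinf hy.1 hy₀
  obtain ⟨α, hα⟩ := hA.exists_forall_lie_eq_smul hv hx.1
  obtain ⟨ε, hε⟩ := hA.exists_forall_lie_eq_smul hv hy.1
  have eq_zero_iff {i : ℕ} {w : L} {c : F} (hi : 1 ≤ i) (h : ⁅v i, w⁆ = c • v (i + 1)) :
      c = 0 ↔ ⁅v i, w⁆ = 0 := by
    rw [h, smul_eq_zero_iff_left (hv _ (by omega)).2]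
  obtain ⟨δ, hδ, zero, one⟩ := MaxClass.exists_isAdmissible (fun i hi => (hv i hi).2) hα hε
    fun i hi => by
      rw [Ne, Ne, eq_zero_iff hi (hα i hi), eq_zero_iff hi (hε i hi)]
      obtain rfl | hlt := hi.eq_or_lt
      · exact .inl (hA.lie_ne_zero_of_span_pair_eq hinf hxy)
      · exact hA.lie_ne_zero_or_lie_ne_zero hinf hxy hlt (hv i hi).1 (hv i hi).2
  refine ⟨δ, hδ, zero 1 ((eq_zero_iff le_rfl (hε 1 le_rfl)).2 (lie_self _)),
    fun i hi => ⟨fun h => ?_, fun h => ?_⟩⟩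
  · rw [← h] at hy
    exact zero i ((eq_zero_iff (by omega) (hε i (by omega))).2 (hy.2 _ (hv i (by omega)).1))
  · rw [← h] at hx
    exact one i (by omega)
      ((eq_zero_iff (by omega) (hα i (by omega))).2 (hx.2 _ (hv i (by omega)).1))

theorem exists_isAdmissible_eqOn_pattern {q r d s : ℕ} (hr : 2 ≤ r) (hd : d < q) (hs : 1 ≤ s)
    (hpat : ConstituentLengthsBeginWith A (initialPattern q r d s))
    (htwo : OnlyFirstTwoUpTo A (initialPattern q r d s).sum) :
    ∃ ε : ℕ → RatFunc F, IsAdmissible ε ∧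
      ∀ x, 1 ≤ x → x + 2 * d ≤ q * r * (s + 1) + 2 * q → ε x = pattern q r d s x := by
  have first : IsFirstConstituent A (2 * q) := hpat.1
  obtain ⟨ε, hε, ε_one, ε_eq⟩ := hA.exists_isAdmissible hinf first.1 first.2.1
  refine ⟨ε, hε, fun x hx hx' => ?_⟩
  obtain rfl | hx := hx.eq_or_lt
  · have : q * 1 ≤ q * r := Nat.mul_le_mul_left q (by omega)
    rw [ε_one, pattern_of_le (by omega), comb_of_gap hr (b := 0) (by omega) (by omega)]
  have ne_iff := hpat.ne_iff_pattern_ne_zero (R := RatFunc F) hr hd hs hx hx'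
  by_cases hC : twoStepCentralizer A x = twoStepCentralizer A 2
  · rw [(ε_eq x hx).1 hC]
    exact (not_not.1 fun h => ne_iff.2 h hC).symm
  · have sum_eq := sum_initialPattern (q := q) (d := d) (s := s) hr (by omega) hs
    obtain ⟨n, hn, hx_eq⟩ := (htwo x hx (by omega)).resolve_left hC
    rw [pattern_eq_one_of_ne_zero (ne_iff.1 hC)]
    exact (ε_eq x hx).2 (first.unique hn ▸ hx_eq)

end IsMaximalClass

end StructureConstants

end MaxClass

theorem mainTheorem5 {F L : Type*} [Field F] [LieRing L] [LieAlgebra F L]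
    (p : ℕ) (hp : p.Prime) (hp2 : p ≠ 2) [CharP F p]
    (A : ℕ → Submodule F L) [GradedLieAlgebra A]
    (hA : MaxClass.IsMaximalClass A) (hinf : ¬ FiniteDimensional F L)
    (h k β s : ℕ) (hk : 1 ≤ k) (hβ : β < h) (hs : 1 ≤ s)
    (hpat : MaxClass.ConstituentLengthsBeginWith A
      (MaxClass.initialPattern (p ^ h) (p ^ k) (p ^ β) s))
    (htwo : MaxClass.OnlyFirstTwoUpTo A
      (MaxClass.initialPattern (p ^ h) (p ^ k) (p ^ β) s).sum) :
    ∃ l : ℕ, s = p ^ l := by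
  have : Fact p.Prime := ⟨hp⟩
  have two_le_r : 2 ≤ p ^ k := hp.two_le.trans (Nat.le_self_pow (by omega) p)
  have d_lt_q : p ^ β < p ^ h := Nat.pow_lt_pow_right hp.one_lt hβ
  obtain ⟨ε, hε, hε_eq⟩ := hA.exists_isAdmissible_eqOn_pattern hinf two_le_r d_lt_q hs hpat htwo
  exact hε.exists_eq_pow_of_eq_pattern hp2 hk hβ hs hε_eq
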